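/- Let $m>\alpha_1\ge 1$ be integers, let $V$ be an $m$-dimensional vector space over $\mathbb F_2$ with a fixed basis, and let $A_1\subset A_2=V$ be subspaces with $\dim A_1=\alpha_1$. Put $\alpha=(\alpha_1,m)$ and let $$\Omega_\alpha(2,m)=\{P\subseteq V:\ \dim P=2,\ \dim(P\cap A_1)\ge 1\}$$ be the corresponding Schubert variety in the Grassmannian of planes of $V$. For each plane $P$ of $V$ choose a basis of $P$ and let $M_P$ be the $2\times m$ matrix whose rows are the coordinates of its vectors. The binary Schubert code $C_\alpha(2,m)\subseteq\mathbb F_2^{\Omega_\alpha(2,m)}$ consists of the words $(f(M_P))_{P\in\Omega_\alpha(2,m)}$, where $f$ runs over the $\mathbb F_2$-linear combinations of the $2\times2$ minors of a generic $2\times m$ matrix. Let $d$ be its minimum distance. For a binary linear code $C$ of length $n$, a set $\mathcal J$ of words of $C^\perp$ is called orthogonal on the coordinate $i$ if every word of $\mathcal J$ has entry $1$ at $i$, and for each $j\ne i$ at most one word of $\mathcal J$ has a nonzero entry at $j$. Given for each $i$ a set $\mathcal J_i$ orthogonal on $i$, the corresponding majority logic decoder changes the $i$-th bit of a received word $r$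 exactly when more than half of the $w\in\mathcal J_i$ satisfy $w\cdot r=1$ (all coordinates being treated simultaneously from the same $r$). We say that majority logic decoding corrects up to $t$ errors for $C$ if there are sets $\mathcal J_1,\dots,\mathcal J_n$, all of the same size, with $\mathcal J_i$ orthogonal on $i$, whose decoder maps $c+e$ to $c$ for every $c\in C$ and every $e\in\mathbb F_2^n$ of Hamming weight at most $t$. Then majority logic decoding for $C_\alpha(2,m)$ corrects 1. up to $\lfloor (d-1)/2\rfloor$ errors when $\alpha_1=2$; 2. up to $\lfloor (d-1)/2\rfloor-1$ errors when $\alpha_1=3$; 3. up to $\lfloor (d-1)/2\rfloor-7$ errors when $\alpha_1=4$. -/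

import Mathlib

open Module

namespace SchubertCode

noncomputable section

/-! ## Linear codes and one-step majority logic decoding -/

/-- The minimum distance of a linear code: the least Hamming distance between two distinct
codewords. -/
def minDist {ι F : Type*} [Fintype ι] [Field F] [DecidableEq F] (C : Submodule F (ι → F)) : ℕ :=
  sInf {d : ℕ | ∃ x ∈ C, ∃ y ∈ C, x ≠ y ∧ hammingDist x y = d}

/-- A parity check of `C` is a word of the dual code. -/
def IsParityCheck {ι F : Type*} [Fintype ι] [Field F] (C : Submodule F (ι → F)) (w : ι → F) :
    Prop :=
  ∀ c ∈ C, dotProduct w c = 0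

/-- A finite set `J` of parity checks of `C` is orthogonal on the coordinate `i`: every check has
entry `1` at `i`, and at every other coordinate at most one check has a nonzero entry. -/
def IsOrthogonalOn {ι F : Type*} [Fintype ι] [Field F] (C : Submodule F (ι → F)) (i : ι)
    (J : Finset (ι → F)) : Prop :=
  (∀ w ∈ J, IsParityCheck C w) ∧ (∀ w ∈ J, w i = 1) ∧
    ∀ j, j ≠ i → ∀ w ∈ J, ∀ w' ∈ J, w j ≠ 0 → w' j ≠ 0 → w = w'

/-- The majority vote on the error at a coordinate, from the checks in `J` and the received
word `r`: it is `1` if strictly more than half of the checks fail on `r`, and `0` otherwise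
(ties are resolved in favour of "no error"). -/
def majorityVote {ι : Type*} [Fintype ι] (J : Finset (ι → ZMod 2)) (r : ι → ZMod 2) : ZMod 2 :=
  if J.card < 2 * (J.filter fun w => dotProduct w r = 1).card then 1 else 0

/-- The binary majority logic decoder given by a set of checks `J i` for every coordinate `i`:
the error estimated at each coordinate is subtracted from the received word `r`. -/
def majorityDecode {ι : Type*} [Fintype ι] (J : ι → Finset (ι → ZMod 2)) (r : ι → ZMod 2) :
    ι → ZMod 2 :=
  fun i => r i - majorityVote (J i) r

/-- Majority logic decoding corrects up to `t` errors for the binary code `C`: for some number `N`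
there are, for every coordinate, `N` parity checks of `C` orthogonal on that coordinate, such that
the corresponding majority logic decoder recovers every codeword affected by at most `t` errors. -/
def MajorityLogicCorrects {ι : Type*} [Fintype ι] (C : Submodule (ZMod 2) (ι → ZMod 2)) (t : ℕ) :
    Prop :=
  ∃ (N : ℕ) (J : ι → Finset (ι → ZMod 2)),
    (∀ i, IsOrthogonalOn C i (J i) ∧ (J i).card = N) ∧
      ∀ c ∈ C, ∀ e : ι → ZMod 2, hammingNorm e ≤ t → majorityDecode J (c + e) = c

/-! ## Grassmannians, Schubert varieties and their codes -/

/-- The Grassmannian of `ℓ`-dimensional linear subspaces of `V`. -/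
abbrev Grassmannian (F V : Type*) [Field F] [AddCommGroup V] [Module F V] (ℓ : ℕ) : Type _ :=
  {P : Submodule F V // finrank F P = ℓ}

/-- `A` is a partial flag of dimension sequence `α`. -/
def IsPartialFlag {F V : Type*} [Field F] [AddCommGroup V] [Module F V] {ℓ : ℕ}
    (A : Fin ℓ → Submodule F V) (α : Fin ℓ → ℕ) : Prop :=
  Monotone A ∧ ∀ i, finrank F (A i) = α i

/-- The Schubert variety of the partial flag `A`: the points `P` of the Grassmannian whose
intersection with the `k`-th flag member (`k = 1, …, ℓ`) has dimension at least `k`. -/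
def schubertVariety {F V : Type*} [Field F] [AddCommGroup V] [Module F V] {ℓ : ℕ}
    (A : Fin ℓ → Submodule F V) : Set (Grassmannian F V ℓ) :=
  {P | ∀ i : Fin ℓ, (i : ℕ) + 1 ≤ finrank F (P.1 ⊓ A i : Submodule F V)}

instance instFintypeSchubertVariety {F V : Type*} [Field F] [AddCommGroup V] [Module F V] [Finite V]
    {ℓ : ℕ} (A : Fin ℓ → Submodule F V) : Fintype (schubertVariety A) :=
  Fintype.ofFinite _

/-- The space of forms spanned by the maximal minors of the generic `ℓ × m` matrix. -/
def minorForms (F : Type*) [Field F] (ℓ m : ℕ) : Submodule F (MvPolynomial (Fin ℓ × Fin m) F) :=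
  Submodule.span F (Set.range fun s : Fin ℓ ↪o Fin m =>
    ((Matrix.mvPolynomialX (Fin ℓ) (Fin m) F).submatrix id s).det)

/-- The `ℓ × m` matrix whose rows are the coordinates, with respect to the basis `b` of `V`, of the
chosen basis `B P` of `P`. -/
def pointMatrix {F V : Type*} [Field F] [AddCommGroup V] [Module F V] {ℓ m : ℕ}
    (b : Basis (Fin m) F V) (B : ∀ P : Grassmannian F V ℓ, Basis (Fin ℓ) F P.1)
    (P : Grassmannian F V ℓ) : Matrix (Fin ℓ) (Fin m) F :=
  Matrix.of fun i j => b.repr (B P i : V) j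

/-- Evaluation of polynomials in the entries of a generic matrix at all points of the
Grassmannian. -/
def evalPoints {F V : Type*} [Field F] [AddCommGroup V] [Module F V] {ℓ m : ℕ}
    (b : Basis (Fin m) F V) (B : ∀ P : Grassmannian F V ℓ, Basis (Fin ℓ) F P.1) :
    MvPolynomial (Fin ℓ × Fin m) F →ₗ[F] (Grassmannian F V ℓ → F) :=
  LinearMap.pi fun P =>
    (MvPolynomial.aeval fun ij : Fin ℓ × Fin m => pointMatrix b B P ij.1 ij.2).toLinearMap

/-- The Grassmann code. -/
def grassmannCode {F V : Type*} [Field F] [AddCommGroup V] [Module F V] {ℓ m : ℕ}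
    (b : Basis (Fin m) F V) (B : ∀ P : Grassmannian F V ℓ, Basis (Fin ℓ) F P.1) :
    Submodule F (Grassmannian F V ℓ → F) :=
  (minorForms F ℓ m).map (evalPoints b B)

/-- The Schubert code: the Grassmann code punctured outside the Schubert variety of `A`. -/
def schubertCode {F V : Type*} [Field F] [AddCommGroup V] [Module F V] {ℓ m : ℕ}
    (b : Basis (Fin m) F V) (B : ∀ P : Grassmannian F V ℓ, Basis (Fin ℓ) F P.1)
    (A : Fin ℓ → Submodule F V) : Submodule F (schubertVariety A → F) :=
  (grassmannCode b B).map (LinearMap.funLeft F F (Subtype.val : schubertVariety A → _))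

end

end SchubertCode

/-! Over `𝔽₂` all bases of a plane `⟨p, q⟩` have the same Plücker vector `p ∧ q`. Codewords are
therefore values of alternating forms on planes, and a set of planes whose Plücker vectors add up to
zero is a parity check. To decode the bit at `⟨p, q⟩` it suffices to have `N` pairwise disjoint
lists of other planes of the Schubert variety, each with Plücker sum `p ∧ q`. They give `N`
orthogonal checks, and an error elsewhere spoils at most one of them, so `⌊N/2⌋` errors are
corrected.

Of the minimum distance only the upper bound `d ≤ 2^(m + α₁ - 3)` matters
(`minDist_schubertCode_le`).

Let `A = A₁`. For a plane `⟨a, x⟩` with `a ∈ A` and `x ∉ A`, write `V = U ⊕ ⟨x⟩ ⊕ B ⊕ ⟨a⟩` with `A =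
B ⊕ ⟨a⟩`. Four kinds of lists (`pencilChecks`, `quadrupleChecks`, `pairChecks`, `cyclicChecks`) have
sum `a ∧ x`. For `α₁ = 2, 3, 4` there are `2^(m + α₁ - 3)` minus `1`, `3`, `15` of them, which
explains the losses `0`, `1`, `7`.

For a plane inside `A` two other kinds (`incidentChecks`, `cosetChecks`) are numerous enough unless
`α₁ = 4` and `m = 5`. In that case `A` is a hyperplane, every plane lies in the Schubert variety,
and `A` can be replaced by a hyperplane that does not contain the given plane. -/

set_option linter.unusedSectionVars false

namespace SchubertCode

/-! ### One-step majority logic decoding from orthogonal checks -/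

section Decoding

variable {ι : Type*} [Fintype ι]

/-- A check that misjudges the error at `i` has an erroneous position other than `i` in its support;
by orthogonality different checks have different such positions. -/
theorem card_filter_dotProduct_ne_le {C : Submodule (ZMod 2) (ι → ZMod 2)} {i : ι}
    {J : Finset (ι → ZMod 2)} (hJ : IsOrthogonalOn C i J) (e : ι → ZMod 2) [DecidableEq ι] :
    (J.filter fun w => dotProduct w e ≠ e i).card ≤
      ((Finset.univ.filter fun j => e j ≠ 0).erase i).card := by
  have key : ∀ w ∈ J.filter (fun w => dotProduct w e ≠ e i), ∃ j, j ≠ i ∧ w j ≠ 0 ∧ e j ≠ 0 := by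
    intro w hw
    rw [Finset.mem_filter] at hw
    by_contra! h
    apply hw.2
    rw [dotProduct, Finset.sum_eq_single i, hJ.2.1 w hw.1, one_mul]
    · intro j _ hj
      by_cases hw0 : w j = 0
      · simp [hw0]
      · simp [h j hj hw0]
    · simp
  have : Nonempty ι := ⟨i⟩
  choose! g hg using key
  refine Finset.card_le_card_of_injOn g ?_ ?_
  · intro w hw
    have := hg w hw
    simp [this.1, this.2.2]
  · intro w hw w' hw' heq
    have h1 := hg w hw
    have h2 := hg w' hw'
    rw [Finset.mem_coe, Finset.mem_filter] at hw hw'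
    exact hJ.2.2 (g w) h1.1 w hw.1 w' hw'.1 h1.2.1 (heq ▸ h2.2.1)

theorem majorityLogicCorrects_of_orthogonal {C : Submodule (ZMod 2) (ι → ZMod 2)} {N t : ℕ}
    (htN : 2 * t ≤ N) (J : ι → Finset (ι → ZMod 2))
    (hJ : ∀ i, IsOrthogonalOn C i (J i) ∧ (J i).card = N) : MajorityLogicCorrects C t := by
  classical
  refine ⟨N, J, hJ, fun c hc e he => funext fun i => ?_⟩
  obtain ⟨ho, hN⟩ := hJ i
  have hb := card_filter_dotProduct_ne_le ho e
  have hsplit := Finset.card_filter_add_card_filter_not (s := J i) (fun w => dotProduct w e = e i)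
  have hr : ((J i).filter fun w => dotProduct w (c + e) = 1) =
      (J i).filter fun w => dotProduct w e = 1 :=
    Finset.filter_congr fun w hw => by rw [dotProduct_add, ho.1 w hw c hc, zero_add]
  have hsupp : (Finset.univ.filter fun j => e j ≠ 0).card ≤ t := by
    simpa [hammingNorm] using he
  rw [majorityDecode, majorityVote, hr, Pi.add_apply]
  have h01 : e i = 0 ∨ e i = 1 := by
    generalize e i = x; revert x; decide
  rcases h01 with h0 | h1
  · rw [h0] at hb
    have hle : ((J i).filter fun w => dotProduct w e = 1).card ≤ t := by
      refine le_trans (Finset.card_le_card ?_) (hb.trans ((Finset.card_erase_le).trans hsupp))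
      intro w hw
      rw [Finset.mem_filter] at hw ⊢
      exact ⟨hw.1, by rw [hw.2]; decide⟩
    -- At most `t` of the `N ≥ 2t` checks fail, which is no strict majority.
    rw [if_neg (by omega), h0]
    simp
  · rw [h1] at hb hsplit
    -- The error at `i` spoils no check, so at most `t - 1` checks are satisfied and a strict
    -- majority fails even when `N = 2t`.
    rw [Finset.card_erase_of_mem (by simp [h1])] at hb
    change ((J i).filter fun w => ¬ dotProduct w e = 1).card ≤ _ at hb
    have hpos : 0 < (Finset.univ.filter fun j => e j ≠ 0).card :=
      Finset.card_pos.mpr ⟨i, by simp [h1]⟩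
    rw [if_pos (by omega), h1]
    simp

end Decoding

/-! ### Codewords as alternating forms -/

section Forms

variable {V : Type*} [AddCommGroup V] [Module (ZMod 2) V]

theorem zmod_two_eq (x : ZMod 2) : x = 0 ∨ x = 1 := by
  revert x; decide

theorem add_self_zmod_two (v : V) : v + v = 0 := by
  rw [← two_smul (ZMod 2) v, show (2 : ZMod 2) = 0 from rfl, zero_smul]

theorem mem_span_pair_iff {p q v : V} :
    v ∈ Submodule.span (ZMod 2) {p, q} ↔ v = 0 ∨ v = p ∨ v = q ∨ v = p + q := by
  rw [Submodule.mem_span_pair]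
  constructor
  · rintro ⟨x, y, rfl⟩
    rcases zmod_two_eq x with rfl | rfl <;> rcases zmod_two_eq y with rfl | rfl <;> simp
  · rintro (rfl | rfl | rfl | rfl)
    · exact ⟨0, 0, by simp⟩
    · exact ⟨1, 0, by simp⟩
    · exact ⟨0, 1, by simp⟩
    · exact ⟨1, 1, by simp⟩

theorem finrank_span_pair {p q : V} (hp : p ≠ 0) (hq : q ≠ 0) (hpq : p ≠ q) :
    finrank (ZMod 2) (Submodule.span (ZMod 2) {p, q}) = 2 := by
  have h : LinearIndependent (ZMod 2) ![p, q] := by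
    rw [LinearIndependent.pair_iff]
    intro x y hxy
    rcases zmod_two_eq x with rfl | rfl <;> rcases zmod_two_eq y with rfl | rfl <;>
      simp_all
    have := eq_neg_of_add_eq_zero_left hxy
    rw [← eq_neg_of_add_eq_zero_left (add_self_zmod_two q)] at this
    exact hpq this
  have hr : Set.range ![p, q] = {p, q} := by
    rw [Matrix.range_cons, Matrix.range_cons, Matrix.range_empty, Set.union_empty]
    rfl
  rw [← hr, finrank_span_eq_card h, Fintype.card_fin]

theorem alternating_symm {φ : V →ₗ[ZMod 2] V →ₗ[ZMod 2] ZMod 2} (hφ : ∀ v, φ v v = 0) (u v : V) :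
    φ u v = φ v u := by
  have h := hφ (u + v)
  simp only [map_add, LinearMap.add_apply, hφ, zero_add, add_zero] at h
  have h2 : (2 : ZMod 2) = 0 := rfl
  linear_combination h - φ v u * h2

/-- A change of basis of a plane over `𝔽₂` has determinant `1`. Hence the chosen bases `B` do not
affect the code. -/
theorem alternating_eq_of_mem_span {φ : V →ₗ[ZMod 2] V →ₗ[ZMod 2] ZMod 2} (hφ : ∀ v, φ v v = 0)
    {p q u v : V} (hu : u ∈ Submodule.span (ZMod 2) {p, q})
    (hv : v ∈ Submodule.span (ZMod 2) {p, q}) (hu0 : u ≠ 0) (hv0 : v ≠ 0) (huv : u ≠ v) :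
    φ u v = φ p q := by
  have hs := alternating_symm hφ q p
  rw [mem_span_pair_iff] at hu hv
  rcases hu with rfl | rfl | rfl | rfl <;> rcases hv with rfl | rfl | rfl | rfl <;>
    simp_all [map_add, LinearMap.add_apply]

/-- The alternating form `(u, v) ↦ lam u * mu v - mu u * lam v`. -/
def wedge (lam mu : V →ₗ[ZMod 2] ZMod 2) : V →ₗ[ZMod 2] V →ₗ[ZMod 2] ZMod 2 :=
  lam.smulRight mu - mu.smulRight lam

@[simp] theorem wedge_apply (lam mu : V →ₗ[ZMod 2] ZMod 2) (u v : V) :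
    wedge lam mu u v = lam u * mu v - mu u * lam v := rfl

variable {m : ℕ} (b : Basis (Fin m) (ZMod 2) V)
  (B : ∀ P : Grassmannian (ZMod 2) V 2, Basis (Fin 2) (ZMod 2) P.1)
  (A : Fin 2 → Submodule (ZMod 2) V)

/-- The word of the values of a bilinear form at the points of a Schubert variety of planes. -/
noncomputable def formWord : (V →ₗ[ZMod 2] V →ₗ[ZMod 2] ZMod 2) →ₗ[ZMod 2] (schubertVariety A → ZMod 2) where
  toFun φ Q := φ (B Q.1 0) (B Q.1 1)
  map_add' _ _ := rfl
  map_smul' _ _ := rfl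

theorem formWord_apply (φ : V →ₗ[ZMod 2] V →ₗ[ZMod 2] ZMod 2) (Q : schubertVariety A) :
    formWord B A φ Q = φ (B Q.1 0) (B Q.1 1) := rfl

theorem schubertCode_eq_map : schubertCode b B A =
    (Submodule.span (ZMod 2) (Set.range fun s : Fin 2 ↪o Fin m =>
      wedge (b.coord (s 0)) (b.coord (s 1)))).map (formWord B A) := by
  rw [schubertCode, grassmannCode, minorForms, Submodule.map_span, Submodule.map_span,
    Submodule.map_span, ← Set.range_comp, ← Set.range_comp, ← Set.range_comp]
  congr 2
  funext s
  funext Q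
  simp [LinearMap.funLeft_apply, evalPoints, formWord_apply, Matrix.det_fin_two, pointMatrix,
    Matrix.mvPolynomialX_apply]

theorem exists_form_of_mem_schubertCode {c : schubertVariety A → ZMod 2}
    (hc : c ∈ schubertCode b B A) :
    ∃ φ : V →ₗ[ZMod 2] V →ₗ[ZMod 2] ZMod 2, (∀ v, φ v v = 0) ∧ c = formWord B A φ := by
  rw [schubertCode_eq_map] at hc
  obtain ⟨φ, hφ, rfl⟩ := hc
  refine ⟨φ, ?_, rfl⟩
  induction hφ using Submodule.span_induction with
  | mem x hx => obtain ⟨s, rfl⟩ := hx; intro v; simp [mul_comm]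
  | zero => simp
  | add x y _ _ hx hy => intro v; simp [hx v, hy v]
  | smul r x _ hx => intro v; simp [hx v]

theorem formWord_wedge_coord_mem (i j : Fin m) :
    formWord B A (wedge (b.coord i) (b.coord j)) ∈ schubertCode b B A := by
  have hlt : ∀ i j : Fin m, i < j →
      formWord B A (wedge (b.coord i) (b.coord j)) ∈ schubertCode b B A := by
    intro i j hij
    rw [schubertCode_eq_map]
    refine Submodule.mem_map_of_mem (Submodule.subset_span ⟨OrderEmbedding.ofStrictMono ![i, j] ?_, ?_⟩)
    · intro x y hxy
      fin_cases x <;> fin_cases y <;> simp_all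
    · simp [OrderEmbedding.ofStrictMono]
  rcases lt_trichotomy i j with h | rfl | h
  · exact hlt i j h
  · have : wedge (b.coord i) (b.coord i) = 0 :=
      LinearMap.ext fun u => LinearMap.ext fun v => by simp
    rw [this, map_zero]
    exact zero_mem _
  · have : wedge (b.coord i) (b.coord j) = wedge (b.coord j) (b.coord i) :=
      LinearMap.ext fun u => LinearMap.ext fun v => by
        have h2 : (2 : ZMod 2) = 0 := rfl
        simp only [wedge_apply]
        linear_combination (b.coord i u * b.coord j v - b.coord j u * b.coord i v) * h2
    rw [this]
    exact hlt j i h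

/-- Bilinear expansion involves all pairs of coordinates, while the minors give only increasing
ones; in characteristic two the order of a pair is irrelevant. -/
theorem formWord_wedge_mem (lam mu : V →ₗ[ZMod 2] ZMod 2) :
    formWord B A (wedge lam mu) ∈ schubertCode b B A := by
  have hexp : wedge lam mu = ∑ i, ∑ j, (lam (b i) * mu (b j)) • wedge (b.coord i) (b.coord j) := by
    refine b.ext fun k => b.ext fun l => ?_
    simp [LinearMap.sum_apply, mul_sub, Finset.sum_sub_distrib, Finsupp.single_apply]
    ring
  rw [hexp, map_sum]
  refine sum_mem fun i _ => ?_
  rw [map_sum]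
  refine sum_mem fun j _ => ?_
  rw [map_smul]
  exact Submodule.smul_mem _ _ (formWord_wedge_coord_mem b B A i j)

end Forms

/-! ### Linear functionals and planes over `𝔽₂` -/

section Planes

variable {V : Type*} [AddCommGroup V] [Module (ZMod 2) V]

theorem exists_dual_eq_one {v : V} (hv : v ≠ 0) : ∃ f : V →ₗ[ZMod 2] ZMod 2, f v = 1 := by
  by_contra! h
  exact hv ((Module.forall_dual_apply_eq_zero_iff (ZMod 2) v).mp
    fun f => (zmod_two_eq (f v)).resolve_right (h f))

theorem exists_dual_eq_one_of_notMem {S : Submodule (ZMod 2) V} {v : V} (hv : v ∉ S) :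
    ∃ f : V →ₗ[ZMod 2] ZMod 2, f v = 1 ∧ ∀ s ∈ S, f s = 0 := by
  obtain ⟨f, hf, hS⟩ := Submodule.exists_le_ker_of_notMem hv
  exact ⟨f, (zmod_two_eq (f v)).resolve_left hf, fun s hs => hS hs⟩

theorem card_eq_two_pow_finrank [Finite V] : Nat.card V = 2 ^ finrank (ZMod 2) V := by
  have := Module.natCard_eq_pow_finrank (K := ZMod 2) (V := V)
  simpa using this

theorem finrank_ker_add_one [Finite V] {f : V →ₗ[ZMod 2] ZMod 2} {v : V} (hv : f v = 1) :
    finrank (ZMod 2) (LinearMap.ker f) + 1 = finrank (ZMod 2) V := by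
  have hf : f ≠ 0 := by rintro rfl; simp at hv
  have h := LinearMap.finrank_range_add_finrank_ker f
  rw [LinearMap.range_eq_top.mpr (LinearMap.surjective hf), finrank_top, finrank_self] at h
  omega

theorem card_dual_eq_one [Finite V] {f : V →ₗ[ZMod 2] ZMod 2} {v : V} (hv : f v = 1) :
    Nat.card {w // f w = 1} = 2 ^ (finrank (ZMod 2) V - 1) := by
  have e : {w // f w = 1} ≃ LinearMap.ker f :=
    { toFun := fun w => ⟨w.1 - v, by simp [w.2, hv]⟩
      invFun := fun w => ⟨w.1 + v, by simp [hv]⟩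
      left_inv := fun w => by simp
      right_inv := fun w => by simp }
  rw [Nat.card_congr e, card_eq_two_pow_finrank, ← finrank_ker_add_one hv, Nat.add_sub_cancel]

theorem exists_eq_span_pair [Finite V] {P : Submodule (ZMod 2) V} (hP : finrank (ZMod 2) P = 2)
    {a : V} (ha : a ∈ P) (ha0 : a ≠ 0) :
    ∃ v ∈ P, v ≠ 0 ∧ a ≠ v ∧ P = Submodule.span (ZMod 2) {a, v} := by
  have hlt : ¬ P ≤ Submodule.span (ZMod 2) {a} := fun hle => by
    have := Submodule.finrank_mono hle
    rw [hP, finrank_span_singleton ha0] at this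
    omega
  obtain ⟨v, hvP, hv⟩ := SetLike.not_le_iff_exists.mp hlt
  have hv0 : v ≠ 0 := fun h => hv (h ▸ zero_mem _)
  have hva : a ≠ v := fun h => hv (h ▸ Submodule.mem_span_singleton_self a)
  refine ⟨v, hvP, hv0, hva, (Submodule.eq_of_le_of_finrank_eq ?_ ?_).symm⟩
  · rw [Submodule.span_le]
    rintro x (rfl | rfl)
    · exact ha
    · exact hvP
  · rw [hP, finrank_span_pair ha0 hv0 hva]

end Planes

/-! ### Values of forms at points of the Schubert variety -/

section Words

variable {V : Type*} [AddCommGroup V] [Module (ZMod 2) V]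
  (B : ∀ P : Grassmannian (ZMod 2) V 2, Basis (Fin 2) (ZMod 2) P.1)
  (A : Fin 2 → Submodule (ZMod 2) V)

theorem formWord_eq {φ : V →ₗ[ZMod 2] V →ₗ[ZMod 2] ZMod 2} (hφ : ∀ v, φ v v = 0)
    {Q : schubertVariety A} {p q : V} (hQ : Q.1.1 = Submodule.span (ZMod 2) {p, q}) :
    formWord B A φ Q = φ p q := by
  refine alternating_eq_of_mem_span hφ (hQ ▸ (B Q.1 0).2) (hQ ▸ (B Q.1 1).2) ?_ ?_ ?_
  · simpa using (B Q.1).ne_zero 0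
  · simpa using (B Q.1).ne_zero 1
  · exact fun h => absurd ((B Q.1).injective (Subtype.ext h)) (by decide)

variable {A} in
theorem span_pair_mem_schubertVariety [Finite V] (hA1 : A 1 = ⊤) {u v : V} (hu : u ∈ A 0)
    (hu0 : u ≠ 0) (h : finrank (ZMod 2) (Submodule.span (ZMod 2) {u, v}) = 2) :
    (⟨Submodule.span (ZMod 2) {u, v}, h⟩ : Grassmannian (ZMod 2) V 2) ∈ schubertVariety A := by
  refine Fin.forall_fin_two.mpr ⟨Nat.one_le_iff_ne_zero.mpr fun h => hu0 ?_, ?_⟩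
  · have := Submodule.finrank_eq_zero.mp h
    exact (Submodule.mem_bot (ZMod 2)).mp (this ▸ ⟨Submodule.subset_span (by simp), hu⟩)
  · change 2 ≤ finrank (ZMod 2) (Submodule.span (ZMod 2) {u, v} ⊓ A 1 : Submodule (ZMod 2) V)
    rw [hA1, inf_top_eq, h]

end Words

/-! ### Upper bound for the minimum distance -/

section MinDist

variable {V : Type*} [AddCommGroup V] [Module (ZMod 2) V] [Finite V] {m : ℕ}
  (b : Basis (Fin m) (ZMod 2) V)
  (B : ∀ P : Grassmannian (ZMod 2) V 2, Basis (Fin 2) (ZMod 2) P.1)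
  (A : Fin 2 → Submodule (ZMod 2) V)

/-- The word of `lam ∧ mu`, with `mu` zero on `A 0` and `lam` not, has small weight: a plane in its
support is spanned by some `u ∈ A 0` with `lam u = 1` and some `v ∈ ker lam` with `mu v = 1`, which
leaves `2^(s-1) * 2^(m-2)` pairs. -/
theorem minDist_schubertCode_le {s : ℕ} (hs : 0 < s) (hsm : s < m)
    (hA : IsPartialFlag A ![s, m]) :
    minDist (schubertCode b B A) ≤ 2 ^ (m + s - 3) := by
  have hV : finrank (ZMod 2) V = m := by simpa using finrank_eq_card_basis b
  have hA0 : finrank (ZMod 2) (A 0) = s := hA.2 0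
  have hA1 : A 1 = ⊤ := Submodule.eq_top_of_finrank_eq ((hA.2 1).trans hV.symm)
  obtain ⟨a, haA, ha0⟩ := (A 0).ne_bot_iff.mp fun h => by
    rw [h, finrank_bot] at hA0; omega
  obtain ⟨z, hz⟩ : ∃ z, z ∉ A 0 := by
    by_contra! h
    rw [(Submodule.eq_top_iff'.mpr h : A 0 = ⊤), finrank_top] at hA0
    omega
  obtain ⟨lam, hlam⟩ := exists_dual_eq_one ha0
  obtain ⟨mu, hmuz, hmu⟩ := exists_dual_eq_one_of_notMem hz
  have hy : ∃ y, lam y = 0 ∧ mu y = 1 := by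
    refine ⟨z - lam z • a, ?_, ?_⟩ <;> simp [hlam, hmuz, hmu a haA]
  obtain ⟨y, hy0, hy1⟩ := hy
  have halt : ∀ v, wedge lam mu v v = 0 := fun v => by simp [mul_comm]
  have hmemw := formWord_wedge_mem b B A lam mu
  set w := formWord B A (wedge lam mu) with hw
  have hplane : ∀ Q : schubertVariety A, w Q ≠ 0 → ∃ u v, u ∈ A 0 ∧ lam u = 1 ∧ lam v = 0 ∧
      mu v = 1 ∧ Q.1.1 = Submodule.span (ZMod 2) {u, v} := by
    intro Q hQ
    have h1 : 1 ≤ finrank (ZMod 2) (Q.1.1 ⊓ A 0 : Submodule (ZMod 2) V) := Q.2 0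
    obtain ⟨u, hu, hu0⟩ := (Q.1.1 ⊓ A 0).ne_bot_iff.mp fun h => by
      rw [h, finrank_bot] at h1; omega
    obtain ⟨v, -, -, -, hQv⟩ := exists_eq_span_pair Q.1.2 hu.1 hu0
    rw [hw, formWord_eq B A halt hQv, wedge_apply, hmu u hu.2, zero_mul, sub_zero,
      mul_ne_zero_iff] at hQ
    have hlu := (zmod_two_eq _).resolve_left hQ.1
    have hmv := (zmod_two_eq _).resolve_left hQ.2
    rcases zmod_two_eq (lam v) with h | h
    · exact ⟨u, v, hu.2, hlu, h, hmv, hQv⟩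
    -- Since `lam u = 1` and `mu u = 0`, passing to `u + v` makes `lam` vanish and keeps `mu`.
    · refine ⟨u, u + v, hu.2, hlu, by rw [map_add, hlu, h]; rfl, by simp [hmu u hu.2, hmv], ?_⟩
      ext x
      rw [hQv, mem_span_pair_iff, mem_span_pair_iff, ← add_assoc, add_self_zmod_two, zero_add]
      tauto
  choose! f g hfA hf1 hg0 hg1 hfg using hplane
  have hcard : hammingNorm w ≤ 2 ^ (m + s - 3) := by
    have hinj : Function.Injective (fun Q : {Q // w Q ≠ 0} =>
        ((⟨⟨f Q.1, hfA Q.1 Q.2⟩, hf1 Q.1 Q.2⟩, ⟨⟨g Q.1, hg0 Q.1 Q.2⟩, hg1 Q.1 Q.2⟩) :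
          {u : A 0 // lam.domRestrict (A 0) u = 1} ×
          {v : LinearMap.ker lam // mu.domRestrict (LinearMap.ker lam) v = 1})) := by
      intro Q Q' h
      rw [Prod.mk.injEq] at h
      refine Subtype.ext (Subtype.ext (Subtype.ext ?_))
      have hf : f Q.1 = f Q'.1 := congrArg (fun u => (u.1 : V)) h.1
      have hg : g Q.1 = g Q'.1 := congrArg (fun u => (u.1 : V)) h.2
      rw [hfg Q.1 Q.2, hfg Q'.1 Q'.2, hf, hg]
    have h := Nat.card_le_card_of_injective _ hinj
    rw [Nat.card_prod, card_dual_eq_one (v := ⟨a, haA⟩) (by simpa using hlam),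
      card_dual_eq_one (v := ⟨y, hy0⟩) (by simpa using hy1), hA0, ← pow_add] at h
    have hk := finrank_ker_add_one hlam
    have he : s - 1 + (finrank (ZMod 2) (LinearMap.ker lam) - 1) = m + s - 3 := by omega
    rw [he, Nat.card_eq_fintype_card, Fintype.card_subtype] at h
    simpa [hammingNorm] using h
  refine le_trans (Nat.sInf_le ⟨w, hmemw, 0, zero_mem _, ?_, rfl⟩) (by simpa using hcard)
  -- The word is nonzero because its value at `⟨a, y⟩` is `1`.
  have hy_ne : y ≠ 0 := by rintro rfl; simp at hy1
  have hay : a ≠ y := by rintro rfl; simp [hy0] at hlam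
  have hfr := finrank_span_pair ha0 hy_ne hay
  have hQ := span_pair_mem_schubertVariety hA1 haA ha0 hfr
  intro h0
  have h1 := congrFun h0 ⟨_, hQ⟩
  rw [hw, formWord_eq B A halt rfl] at h1
  simp [hlam, hy0, hy1] at h1

end MinDist

/-! ### Orthogonal checks from lists of planes with a given Plücker sum -/

section CheckFamily

variable {V : Type*} [AddCommGroup V] [Module (ZMod 2) V]

/-- A family `L` of lists of planes meeting `A`, each plane given by a basis whose first vector
lies in `A`, such that the Plücker vectors of the planes of each list add up to that of `⟨p, q⟩`,
different lists have no plane in common, and `⟨p, q⟩` does not occur. Adding `⟨p, q⟩` to each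
list gives parity checks orthogonal on `⟨p, q⟩`. -/
structure IsCheckFamily (A : Submodule (ZMod 2) V) (p q : V) {κ : Type*} (L : κ → List (V × V)) :
    Prop where
  mem : ∀ j, ∀ z ∈ L j, z.1 ∈ A
  indep : ∀ j, ∀ z ∈ L j, z.1 ≠ 0 ∧ z.2 ≠ 0 ∧ z.1 ≠ z.2
  sum : ∀ j, ∀ φ : V →ₗ[ZMod 2] V →ₗ[ZMod 2] ZMod 2, (∀ v, φ v v = 0) →
    ((L j).map fun z => φ z.1 z.2).sum = φ p q
  ne : ∀ j, ∀ z ∈ L j, Submodule.span (ZMod 2) {z.1, z.2} ≠ Submodule.span (ZMod 2) {p, q}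
  disj : ∀ j j', ∀ z ∈ L j, ∀ z' ∈ L j',
    Submodule.span (ZMod 2) {z.1, z.2} = Submodule.span (ZMod 2) {z'.1, z'.2} → j = j'

/-- This allows families to be built in adapted coordinates and then carried to `V`; forms on `V`
are pulled back along `f`. -/
theorem IsCheckFamily.map {X : Type*} [AddCommGroup X] [Module (ZMod 2) X]
    {A₀ : Submodule (ZMod 2) X} {p q : X} {κ : Type*} {L : κ → List (X × X)}
    (h : IsCheckFamily A₀ p q L) {f : X →ₗ[ZMod 2] V} (hf : Function.Injective f)
    {A : Submodule (ZMod 2) V} (hA : ∀ x ∈ A₀, f x ∈ A) :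
    IsCheckFamily A (f p) (f q) fun j => (L j).map (Prod.map f f) := by
  have hspan : ∀ u v u' v' : X, Submodule.span (ZMod 2) {f u, f v} =
      Submodule.span (ZMod 2) {f u', f v'} →
      Submodule.span (ZMod 2) {u, v} = Submodule.span (ZMod 2) {u', v'} := by
    intro u v u' v' he
    apply Submodule.map_injective_of_injective hf
    simpa [Submodule.map_span, Set.image_pair] using he
  constructor
  · intro j z hz
    obtain ⟨y, hy, rfl⟩ := List.mem_map.mp hz
    exact hA _ (h.mem j y hy)
  · intro j z hz
    obtain ⟨y, hy, rfl⟩ := List.mem_map.mp hz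
    obtain ⟨h1, h2, h3⟩ := h.indep j y hy
    exact ⟨(map_ne_zero_iff f hf).mpr h1, (map_ne_zero_iff f hf).mpr h2, hf.ne h3⟩
  · intro j φ hφ
    simpa [Function.comp_def] using h.sum j (φ.compl₁₂ f f) fun v => hφ (f v)
  · intro j z hz he
    obtain ⟨y, hy, rfl⟩ := List.mem_map.mp hz
    exact h.ne j y hy (hspan _ _ _ _ he)
  · intro j j' z hz z' hz' he
    obtain ⟨y, hy, rfl⟩ := List.mem_map.mp hz
    obtain ⟨y', hy', rfl⟩ := List.mem_map.mp hz'
    exact h.disj j j' y hy y' hy' (hspan _ _ _ _ he)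

theorem IsCheckFamily.sumElim {A : Submodule (ZMod 2) V} {p q : V} {κ κ' : Type*}
    {L : κ → List (V × V)} {L' : κ' → List (V × V)} (h : IsCheckFamily A p q L)
    (h' : IsCheckFamily A p q L') (hd : ∀ j, ∀ z ∈ L j, ∀ j', ∀ z' ∈ L' j',
      Submodule.span (ZMod 2) {z.1, z.2} ≠ Submodule.span (ZMod 2) {z'.1, z'.2}) :
    IsCheckFamily A p q (Sum.elim L L') := by
  constructor
  · rintro (j | j)
    exacts [h.mem j, h'.mem j]
  · rintro (j | j)
    exacts [h.indep j, h'.indep j]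
  · rintro (j | j)
    exacts [h.sum j, h'.sum j]
  · rintro (j | j)
    exacts [h.ne j, h'.ne j]
  · rintro (j | j) (j' | j') z hz z' hz' he
    · rw [h.disj j j' z hz z' hz' he]
    · exact (hd j z hz j' z' hz' he).elim
    · exact (hd j' z' hz' j z hz he.symm).elim
    · rw [h'.disj j j' z hz z' hz' he]

/-- The subspace `A'` need not be `A 0`: all that matters is that planes meeting it belong to the
Schubert variety. This freedom is used when `A 0` is a hyperplane. -/
theorem exists_orthogonal_of_isCheckFamily [Finite V] {m : ℕ} (b : Basis (Fin m) (ZMod 2) V)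
    (B : ∀ P : Grassmannian (ZMod 2) V 2, Basis (Fin 2) (ZMod 2) P.1)
    {A : Fin 2 → Submodule (ZMod 2) V} {A' : Submodule (ZMod 2) V}
    (hA : ∀ u v, u ∈ A' → u ≠ 0 → ∀ h : finrank (ZMod 2) (Submodule.span (ZMod 2) {u, v}) = 2,
      (⟨Submodule.span (ZMod 2) {u, v}, h⟩ : Grassmannian (ZMod 2) V 2) ∈ schubertVariety A)
    (Q : schubertVariety A) {p q : V} (hp : p ≠ 0) (hpq : q ∉ Submodule.span (ZMod 2) {p})
    (hQ : Q.1.1 = Submodule.span (ZMod 2) {p, q}) {κ : Type*} [Fintype κ]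
    {L : κ → List (V × V)} (hL : IsCheckFamily A' p q L) :
    ∃ J, IsOrthogonalOn (schubertCode b B A) Q J ∧ J.card = Fintype.card κ := by
  classical
  let W : List (V × V) → schubertVariety A → ZMod 2 := fun l R =>
    (l.map fun z => if R.1.1 = Submodule.span (ZMod 2) {z.1, z.2} then (1 : ZMod 2) else 0).sum
  have hW : ∀ (l : List (V × V)) (R : schubertVariety A),
      (∀ z ∈ l, R.1.1 ≠ Submodule.span (ZMod 2) {z.1, z.2}) → W l R = 0 := by
    intro l R h
    refine List.sum_eq_zero fun x hx => ?_
    obtain ⟨z, hz, rfl⟩ := List.mem_map.mp hx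
    exact if_neg (h z hz)
  let w : κ → schubertVariety A → ZMod 2 := fun j => Pi.single Q 1 + W (L j)
  have hwQ : ∀ j, w j Q = 1 := fun j => by
    have := hW (L j) Q fun z hz he => hL.ne j z hz (he.symm.trans hQ)
    simp [w, this]
  have hwR : ∀ j R, R ≠ Q → w j R ≠ 0 →
      ∃ z ∈ L j, R.1.1 = Submodule.span (ZMod 2) {z.1, z.2} := by
    intro j R hR hne
    by_contra! h
    exact hne (by simp [w, hR, hW (L j) R h])
  have hdisj : ∀ j j' R, R ≠ Q → w j R ≠ 0 → w j' R ≠ 0 → j = j' := by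
    intro j j' R hR h h'
    obtain ⟨z, hz, he⟩ := hwR j R hR h
    obtain ⟨z', hz', he'⟩ := hwR j' R hR h'
    exact hL.disj j j' z hz z' hz' (he.symm.trans he')
  have hdotW : ∀ φ : V →ₗ[ZMod 2] V →ₗ[ZMod 2] ZMod 2, (∀ v, φ v v = 0) →
      ∀ l : List (V × V), (∀ z ∈ l, z.1 ∈ A' ∧ z.1 ≠ 0 ∧ z.2 ≠ 0 ∧ z.1 ≠ z.2) →
      dotProduct (W l) (formWord B A φ) = (l.map fun z => φ z.1 z.2).sum := by
    intro φ hφ l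
    induction l with
    | nil => intro _; simp [W, dotProduct]
    | cons z l ih =>
      intro hl
      obtain ⟨h1, h2, h3, h4⟩ := hl z (by simp)
      let R : schubertVariety A := ⟨⟨_, finrank_span_pair h2 h3 h4⟩, hA _ _ h1 h2 _⟩
      have hcons : W (z :: l) = Pi.single R 1 + W l := by
        funext S
        have : S = R ↔ S.1.1 = Submodule.span (ZMod 2) {z.1, z.2} := by
          rw [Subtype.ext_iff, Subtype.ext_iff]
        simp [W, Pi.single_apply, this]
      rw [hcons, add_dotProduct, ih fun z' hz' => hl z' (by simp [hz']), single_one_dotProduct,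
        formWord_eq B A hφ (Q := R) rfl]
      simp
  have hdot : ∀ j, IsParityCheck (schubertCode b B A) (w j) := by
    intro j c hc
    obtain ⟨φ, hφ, rfl⟩ := exists_form_of_mem_schubertCode b B A hc
    rw [add_dotProduct, hdotW φ hφ _ fun z hz => ⟨hL.mem j z hz, hL.indep j z hz⟩, hL.sum j φ hφ,
      single_one_dotProduct, formWord_eq B A hφ hQ]
    exact add_self_zmod_two _
  have hinj : Function.Injective w := by
    intro j j' h
    by_contra hne
    -- Equal checks with different indices would be supported at `Q` alone by disjointness, so every
    -- codeword would vanish at `Q`; the word of `lam ∧ mu` below does not.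
    have hw : w j = Pi.single Q 1 := by
      funext R
      by_cases hR : R = Q
      · subst hR; simp [hwQ]
      · rw [Pi.single_eq_of_ne hR]
        by_contra h0
        exact hne (hdisj j j' R hR h0 (h ▸ h0))
    obtain ⟨lam, hlam⟩ := exists_dual_eq_one hp
    obtain ⟨mu, hmu, hmup⟩ := exists_dual_eq_one_of_notMem hpq
    have := hdot j _ (formWord_wedge_mem b B A lam mu)
    rw [hw, single_one_dotProduct, formWord_eq B A (fun v => by simp [mul_comm]) hQ] at this
    simp [hlam, hmu, hmup p (Submodule.mem_span_singleton_self p)] at this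
  refine ⟨Finset.univ.image w, ⟨?_, ?_, ?_⟩, by simp [Finset.card_image_of_injective _ hinj]⟩
  · simpa using hdot
  · simpa using hwQ
  · intro R hR
    simp only [Finset.mem_image, Finset.mem_univ, true_and, forall_exists_index,
      forall_apply_eq_imp_iff]
    exact fun j j' h h' => congrArg w (hdisj j j' R hR h h')

end CheckFamily

/-! ### Checks on a plane `⟨a, x⟩` meeting the base in the line of `a` -/

section TransversalFamily

variable (U B : Type*) [AddCommGroup U] [Module (ZMod 2) U] [AddCommGroup B] [Module (ZMod 2) B]

/-- Coordinates adapted to a plane meeting a given subspace, here the set of the vectors whose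
first two components vanish, in a line. -/
abbrev AdaptedSpace : Type _ := U × ZMod 2 × B × ZMod 2

/-- The vectors whose first two components vanish. -/
def AdaptedSpace.base : Submodule (ZMod 2) (AdaptedSpace U B) where
  carrier := {v | v.1 = 0 ∧ v.2.1 = 0}
  add_mem' := by rintro v w ⟨h1, h2⟩ ⟨h3, h4⟩; simp [h1, h2, h3, h4]
  zero_mem' := by simp
  smul_mem' := by rintro c v ⟨h1, h2⟩; simp [h1, h2]

variable {U B}

open AdaptedSpace

theorem AdaptedSpace.mem_base {v : AdaptedSpace U B} : v ∈ base U B ↔ v.1 = 0 ∧ v.2.1 = 0 :=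
  Iff.rfl

/-- Pairs of planes through the vector `(0, 0, 0, 1)`. -/
def pencilChecks (z : {z : U × B // z ≠ 0}) : List (AdaptedSpace U B × AdaptedSpace U B) :=
  [((0, 0, 0, 1), (z.1.1, 0, z.1.2, 0)), ((0, 0, 0, 1), (z.1.1, 1, z.1.2, 0))]

theorem mem_pencilChecks {z : {z : U × B // z ≠ 0}} {w : AdaptedSpace U B × AdaptedSpace U B}
    (hw : w ∈ pencilChecks z) : ∃ η, w = ((0, 0, 0, 1), (z.1.1, η, z.1.2, 0)) := by
  simp only [pencilChecks, List.mem_cons, List.not_mem_nil, or_false] at hw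
  rcases hw with rfl | rfl
  exacts [⟨0, rfl⟩, ⟨1, rfl⟩]

/-- The identity is `a ∧ z + a ∧ (z + x) = a ∧ x`, where `a = (0, 0, 0, 1)` and `x = (0, 1, 0, 0)`.
-/
theorem isCheckFamily_pencilChecks :
    IsCheckFamily (base U B) (0, 0, 0, 1) (0, 1, 0, 0) (pencilChecks (U := U) (B := B)) := by
  constructor
  · intro z w hw
    obtain ⟨η, rfl⟩ := mem_pencilChecks hw
    simp [mem_base]
  · rintro ⟨⟨u, β⟩, hz⟩ w hw
    obtain ⟨η, rfl⟩ := mem_pencilChecks hw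
    rw [Ne, Prod.mk_eq_zero] at hz
    simp
    tauto
  · rintro ⟨⟨u, β⟩, hz⟩ φ hφ
    have he : ((u, 1, β, 0) : AdaptedSpace U B) = (u, 0, β, 0) + (0, 1, 0, 0) := by simp
    simp only [pencilChecks, List.map_cons, List.map_nil, List.sum_cons, List.sum_nil, he, map_add,
      add_zero]
    rw [← add_assoc, add_self_zmod_two, zero_add]
  · rintro ⟨⟨u, β⟩, hz⟩ w hw he
    obtain ⟨η, rfl⟩ := mem_pencilChecks hw
    have h : (u, η, β, 0) ∈ Submodule.span (ZMod 2)
      {((0, 0, 0, 1) : AdaptedSpace U B), (0, 1, 0, 0)} := he ▸ Submodule.subset_span (by simp)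
    rw [Ne, Prod.mk_eq_zero] at hz
    rw [mem_span_pair_iff] at h
    simp at h
    tauto
  · rintro ⟨⟨u, β⟩, hz⟩ ⟨⟨u', β'⟩, hz'⟩ w hw w' hw' he
    obtain ⟨η, rfl⟩ := mem_pencilChecks hw
    obtain ⟨η', rfl⟩ := mem_pencilChecks hw'
    have h : (u, η, β, 0) ∈ Submodule.span (ZMod 2)
      {((0, 0, 0, 1) : AdaptedSpace U B), (u', η', β', 0)} := he ▸ Submodule.subset_span (by simp)
    rw [Ne, Prod.mk_eq_zero] at hz
    rw [mem_span_pair_iff] at h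
    simp at h
    simp
    tauto

/-- Quadruples of planes through `(0, 0, b, 0)` and `(0, 0, b, 1)` that are not contained in the
hyperplane spanned by the base and `(0, 1, 0, 0)`. -/
def quadrupleChecks (h : {b : B // b ≠ 0} → B →ₗ[ZMod 2] ZMod 2)
    (j : (b : {b : B // b ≠ 0}) × {u : U // u ≠ 0} × LinearMap.ker (h b) × ZMod 2) :
    List (AdaptedSpace U B × AdaptedSpace U B) :=
  [((0, 0, j.1.1, 0), (j.2.1.1, 0, j.2.2.1.1, j.2.2.2)),
    ((0, 0, j.1.1, 0), (j.2.1.1, 1, j.2.2.1.1, j.2.2.2)),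
    ((0, 0, j.1.1, 1), (j.2.1.1, 0, j.2.2.1.1, j.2.2.2)),
    ((0, 0, j.1.1, 1), (j.2.1.1, 1, j.2.2.1.1, j.2.2.2))]

theorem mem_quadrupleChecks {h : {b : B // b ≠ 0} → B →ₗ[ZMod 2] ZMod 2}
    {j : (b : {b : B // b ≠ 0}) × {u : U // u ≠ 0} × LinearMap.ker (h b) × ZMod 2}
    {w : AdaptedSpace U B × AdaptedSpace U B} (hw : w ∈ quadrupleChecks h j) :
    ∃ τ η, w = ((0, 0, j.1.1, τ), (j.2.1.1, η, j.2.2.1.1, j.2.2.2)) := by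
  simp only [quadrupleChecks, List.mem_cons, List.not_mem_nil, or_false] at hw
  rcases hw with rfl | rfl | rfl | rfl
  exacts [⟨0, 0, rfl⟩, ⟨0, 1, rfl⟩, ⟨1, 0, rfl⟩, ⟨1, 1, rfl⟩]

/-- With `y = (u, 0, γ, α)`, the two planes through `b` add up to `b ∧ x` and the two through `b +
a` to `(b + a) ∧ x`. Such a plane also contains the sum of its two basis vectors, whose third
component is `γ + b`; taking `γ` in the hyperplane `ker (h b)`, which misses `b`, keeps one
representative and gives disjointness. -/
theorem isCheckFamily_quadrupleChecks {h : {b : B // b ≠ 0} → B →ₗ[ZMod 2] ZMod 2}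
    (hh : ∀ b, h b b = 1) :
    IsCheckFamily (base U B) (0, 0, 0, 1) (0, 1, 0, 0) (quadrupleChecks (U := U) h) := by
  constructor
  · intro j w hw
    obtain ⟨τ, η, rfl⟩ := mem_quadrupleChecks hw
    simp [mem_base]
  · rintro ⟨⟨b, hb⟩, ⟨u, hu⟩, ⟨γ, hγ⟩, α⟩ w hw
    obtain ⟨τ, η, rfl⟩ := mem_quadrupleChecks hw
    simp_all [hu.symm]
  · rintro ⟨⟨b, hb⟩, ⟨u, hu⟩, ⟨γ, hγ⟩, α⟩ φ hφ
    have he : ((u, 1, γ, α) : AdaptedSpace U B) = (u, 0, γ, α) + (0, 1, 0, 0) := by simp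
    have he' : ((0, 0, b, 1) : AdaptedSpace U B) = (0, 0, b, 0) + (0, 0, 0, 1) := by simp
    simp only [quadrupleChecks, List.map_cons, List.map_nil, List.sum_cons, List.sum_nil, he, he',
      map_add, LinearMap.add_apply, add_zero]
    have h2 : (2 : ZMod 2) = 0 := rfl
    linear_combination (φ (0, 0, b, 0) (u, 0, γ, α) + φ (0, 0, b, 0) (u, 0, γ, α) +
      φ (0, 0, 0, 1) (u, 0, γ, α) + φ (0, 0, b, 0) (0, 1, 0, 0)) * h2
  · rintro ⟨⟨b, hb⟩, ⟨u, hu⟩, ⟨γ, hγ⟩, α⟩ w hw he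
    obtain ⟨τ, η, rfl⟩ := mem_quadrupleChecks hw
    have h : (u, η, γ, α) ∈ Submodule.span (ZMod 2)
      {((0, 0, 0, 1) : AdaptedSpace U B), (0, 1, 0, 0)} := he ▸ Submodule.subset_span (by simp)
    rw [mem_span_pair_iff] at h
    simp_all
  · rintro ⟨⟨b, hb⟩, ⟨u, hu⟩, ⟨γ, hγ⟩, α⟩ ⟨⟨b', hb'⟩, ⟨u', hu'⟩, ⟨γ', hγ'⟩, α'⟩ w hw w' hw' he
    obtain ⟨τ, η, rfl⟩ := mem_quadrupleChecks hw
    obtain ⟨τ', η', rfl⟩ := mem_quadrupleChecks hw'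
    have h1 : (0, 0, b, τ) ∈ Submodule.span (ZMod 2)
      {((0, 0, b', τ') : AdaptedSpace U B), (u', η', γ', α')} :=
        he ▸ Submodule.subset_span (by simp)
    have h2 : (u, η, γ, α) ∈ Submodule.span (ZMod 2)
      {((0, 0, b', τ') : AdaptedSpace U B), (u', η', γ', α')} :=
        he ▸ Submodule.subset_span (by simp)
    rw [mem_span_pair_iff] at h1 h2
    obtain rfl : b = b' := by
      simp [hb, hu'.symm] at h1
      exact h1.1
    have hb1 := hh ⟨b, hb⟩
    simp only [LinearMap.mem_ker] at hγ hγ'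
    simp [hu] at h2
    rcases h2 with h2 | h2
    · obtain ⟨rfl, rfl, rfl, rfl⟩ := h2
      rfl
    · exfalso
      rw [h2.2.2.1, map_add, hγ', add_zero, hb1] at hγ
      exact one_ne_zero hγ

/-- Pairs of planes through `(0, 0, b, 0)` and `(0, 0, b, 1)` that contain `(0, 1, 0, ε)`. -/
def pairChecks (j : {b : B // b ≠ 0} × ZMod 2) : List (AdaptedSpace U B × AdaptedSpace U B) :=
  [((0, 0, j.1.1, 0), (0, 1, 0, j.2)), ((0, 0, j.1.1, 1), (0, 1, 0, j.2))]

theorem mem_pairChecks {j : {b : B // b ≠ 0} × ZMod 2}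
    {w : AdaptedSpace U B × AdaptedSpace U B} (hw : w ∈ pairChecks j) :
    ∃ τ, w = ((0, 0, j.1.1, τ), (0, 1, 0, j.2)) := by
  simp only [pairChecks, List.mem_cons, List.not_mem_nil, or_false] at hw
  rcases hw with rfl | rfl
  exacts [⟨0, rfl⟩, ⟨1, rfl⟩]

/-- The identity is `b ∧ (x + εa) + (b + a) ∧ (x + εa) = a ∧ x`. -/
theorem isCheckFamily_pairChecks :
    IsCheckFamily (base U B) (0, 0, 0, 1) (0, 1, 0, 0) (pairChecks (U := U) (B := B)) := by
  constructor
  · intro j w hw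
    obtain ⟨τ, rfl⟩ := mem_pairChecks hw
    simp [mem_base]
  · rintro ⟨⟨b, hb⟩, ε⟩ w hw
    obtain ⟨τ, rfl⟩ := mem_pairChecks hw
    simp_all
  · rintro ⟨⟨b, hb⟩, ε⟩ φ hφ
    have he : ((0, 1, 0, ε) : AdaptedSpace U B) = (0, 1, 0, 0) + ε • (0, 0, 0, 1) := by simp
    have he' : ((0, 0, b, 1) : AdaptedSpace U B) = (0, 0, b, 0) + (0, 0, 0, 1) := by simp
    simp only [pairChecks, List.map_cons, List.map_nil, List.sum_cons, List.sum_nil, he, he',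
      map_add, map_smul, LinearMap.add_apply, add_zero, hφ]
    have h2 : (2 : ZMod 2) = 0 := rfl
    ring_nf
    simp [h2]
  · rintro ⟨⟨b, hb⟩, ε⟩ w hw he
    obtain ⟨τ, rfl⟩ := mem_pairChecks hw
    have h : (0, 0, b, τ) ∈ Submodule.span (ZMod 2)
      {((0, 0, 0, 1) : AdaptedSpace U B), (0, 1, 0, 0)} := he ▸ Submodule.subset_span (by simp)
    rw [mem_span_pair_iff] at h
    simp_all
  · rintro ⟨⟨b, hb⟩, ε⟩ ⟨⟨b', hb'⟩, ε'⟩ w hw w' hw' he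
    obtain ⟨τ, rfl⟩ := mem_pairChecks hw
    obtain ⟨τ', rfl⟩ := mem_pairChecks hw'
    have h1 : (0, 0, b, τ) ∈ Submodule.span (ZMod 2)
      {((0, 0, b', τ') : AdaptedSpace U B), (0, 1, 0, ε')} :=
        he ▸ Submodule.subset_span (by simp)
    have h2 : (0, 1, 0, ε) ∈ Submodule.span (ZMod 2)
      {((0, 0, b', τ') : AdaptedSpace U B), (0, 1, 0, ε')} :=
        he ▸ Submodule.subset_span (by simp)
    rw [mem_span_pair_iff] at h1 h2
    simp_all [hb'.symm]

/-- A set of bases of planes of `B`, one for each of a set of planes. -/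
structure IsPlaneBases (O : Finset (B × B)) : Prop where
  indep : ∀ o ∈ O, o.1 ≠ 0 ∧ o.2 ≠ 0 ∧ o.1 ≠ o.2
  inj : ∀ o ∈ O, ∀ o' ∈ O,
    Submodule.span (ZMod 2) {o.1, o.2} = Submodule.span (ZMod 2) {o'.1, o'.2} → o = o'

/-- Quadruples made of a plane of the base not containing `(0, 0, 0, 1)` and three planes not
contained in the base. -/
def cyclicChecks {O : Finset (B × B)} (j : O × ZMod 2 × ZMod 2) :
    List (AdaptedSpace U B × AdaptedSpace U B) :=
  [((0, 0, j.1.1.1, j.2.1), (0, 0, j.1.1.2, j.2.2)),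
    ((0, 0, j.1.1.1, j.2.1 + 1), (0, 1, j.1.1.2, j.2.2)),
    ((0, 0, j.1.1.2, j.2.2 + 1), (0, 1, j.1.1.1 + j.1.1.2, j.2.1 + j.2.2)),
    ((0, 0, j.1.1.1 + j.1.1.2, j.2.1 + j.2.2 + 1), (0, 1, j.1.1.1, j.2.1))]

theorem span_pair_add_right {V : Type*} [AddCommGroup V] [Module (ZMod 2) V] (p q : V) :
    Submodule.span (ZMod 2) {p, q} = Submodule.span (ZMod 2) {q, p + q} := by
  ext x
  rw [mem_span_pair_iff, mem_span_pair_iff, add_left_comm, add_self_zmod_two, add_zero]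
  tauto

/-- All four planes project isomorphically onto the plane `⟨p, q⟩` of `B`. In this normal form `ξ`
and `η` are the `x`-coordinates of the lifts of `p` and `q`, so `ε` and `δ` can be read off from the
remaining coordinates. The 16 lifts are thus split into four quadruples. -/
theorem span_of_mem_cyclicChecks {O : Finset (B × B)} {j : O × ZMod 2 × ZMod 2}
    {w : AdaptedSpace U B × AdaptedSpace U B} (hw : w ∈ cyclicChecks j) :
    ∃ ξ η : ZMod 2, Submodule.span (ZMod 2) {w.1, w.2} = Submodule.span (ZMod 2)
      {(0, ξ, j.1.1.1, j.2.1 + ξ + η), (0, η, j.1.1.2, j.2.2 + ξ)} := by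
  obtain ⟨⟨⟨p, q⟩, ho⟩, ε, δ⟩ := j
  simp only [cyclicChecks, List.mem_cons, List.not_mem_nil, or_false] at hw
  rcases hw with rfl | rfl | rfl | rfl
  · exact ⟨0, 0, by simp⟩
  · exact ⟨0, 1, by simp⟩
  · refine ⟨1, 0, ?_⟩
    rw [span_pair_add_right (0, 1, p, _)]
    have h2 : (1 + 1 : ZMod 2) = 0 := rfl
    have : ε + 1 + (δ + 1) = ε + δ := by linear_combination h2
    simp [this]
  · refine ⟨1, 1, ?_⟩
    rw [Set.pair_comm (0, 1, p, _),
      span_pair_add_right ((0, 1, q, δ + 1) : AdaptedSpace U B) (0, 1, p, ε + 1 + 1), Set.pair_comm]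
    have h2 : (1 + 1 : ZMod 2) = 0 := rfl
    have h3 : ε + 1 + 1 = ε := by linear_combination h2
    have h4 : δ + 1 + ε = ε + δ + 1 := by ring
    simp [h2, h3, h4, add_comm q p]

/-- With `v = p + εa` and `w = q + δa`, in `v ∧ w + (v + a) ∧ (w + x) + (w + a) ∧ (v + w + x) + (v +
w + a) ∧ (v + x)` the term `a ∧ x` occurs three times and every other term an even number of times.
-/
theorem isCheckFamily_cyclicChecks {O : Finset (B × B)} (hO : IsPlaneBases O) :
    IsCheckFamily (base U B) (0, 0, 0, 1) (0, 1, 0, 0) (cyclicChecks (U := U) (O := O)) := by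
  constructor
  · intro j w hw
    simp only [cyclicChecks, List.mem_cons, List.not_mem_nil, or_false] at hw
    rcases hw with rfl | rfl | rfl | rfl <;> simp [mem_base]
  · rintro ⟨⟨⟨p, q⟩, ho⟩, ε, δ⟩ w hw
    obtain ⟨hp, hq, hpq⟩ := hO.indep _ ho
    have hpq' : p + q ≠ 0 := fun h => hpq (by
      rw [eq_neg_of_add_eq_zero_left h, ← eq_neg_of_add_eq_zero_left (add_self_zmod_two q)])
    simp only [cyclicChecks, List.mem_cons, List.not_mem_nil, or_false] at hw
    rcases hw with rfl | rfl | rfl | rfl <;> simp_all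
  · rintro ⟨⟨⟨p, q⟩, ho⟩, ε, δ⟩ φ hφ
    have h1 : ((0, 0, p, ε + 1) : AdaptedSpace U B) = (0, 0, p, ε) + (0, 0, 0, 1) := by simp
    have h2 : ((0, 0, q, δ + 1) : AdaptedSpace U B) = (0, 0, q, δ) + (0, 0, 0, 1) := by simp
    have h3 : ((0, 1, q, δ) : AdaptedSpace U B) = (0, 0, q, δ) + (0, 1, 0, 0) := by simp
    have h4 : ((0, 1, p, ε) : AdaptedSpace U B) = (0, 0, p, ε) + (0, 1, 0, 0) := by simp
    have h5 : ((0, 1, p + q, ε + δ) : AdaptedSpace U B) =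
      (0, 0, p, ε) + (0, 0, q, δ) + (0, 1, 0, 0) := by simp
    have h6 : ((0, 0, p + q, ε + δ + 1) : AdaptedSpace U B) =
      (0, 0, p, ε) + (0, 0, q, δ) + (0, 0, 0, 1) := by simp
    simp only [cyclicChecks, List.map_cons, List.map_nil, List.sum_cons, List.sum_nil, h1, h2, h3,
      h4, h5, h6]
    generalize ((0, 0, p, ε) : AdaptedSpace U B) = v
    generalize ((0, 0, q, δ) : AdaptedSpace U B) = w
    generalize ((0, 0, 0, 1) : AdaptedSpace U B) = a
    generalize ((0, 1, 0, 0) : AdaptedSpace U B) = x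
    simp only [map_add, LinearMap.add_apply, hφ]
    have h2 : (2 : ZMod 2) = 0 := rfl
    linear_combination (φ v w + φ w v + φ a x + φ v x + φ w x + φ a v + φ a w) * h2
  · rintro j w hw he
    obtain ⟨hp, hq, hpq⟩ := hO.indep _ j.1.2
    obtain ⟨ξ, η, hs⟩ := span_of_mem_cyclicChecks hw
    have h : (0, ξ, j.1.1.1, j.2.1 + ξ + η) ∈ Submodule.span (ZMod 2)
      {((0, 0, 0, 1) : AdaptedSpace U B), (0, 1, 0, 0)} :=
        he ▸ hs ▸ Submodule.subset_span (by simp)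
    rw [mem_span_pair_iff] at h
    simp [hp] at h
  · rintro ⟨o, ε, δ⟩ ⟨o', ε', δ'⟩ w hw w' hw' he
    obtain ⟨ξ, η, hs⟩ := span_of_mem_cyclicChecks hw
    obtain ⟨ξ', η', hs'⟩ := span_of_mem_cyclicChecks hw'
    rw [hs, hs'] at he
    have hoo : o = o' := by
      -- Projection to `B` recovers the plane `o`.
      have := congrArg (Submodule.map (LinearMap.fst (ZMod 2) B (ZMod 2) ∘ₗ
        LinearMap.snd (ZMod 2) (ZMod 2) (B × ZMod 2) ∘ₗ LinearMap.snd (ZMod 2) U _)) he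
      simp only [Submodule.map_span, Set.image_pair] at this
      exact Subtype.ext (hO.inj _ o.2 _ o'.2 this)
    subst hoo
    obtain ⟨hp, hq, hpq⟩ := hO.indep _ o.2
    have h1 : (0, ξ, o.1.1, ε + ξ + η) ∈ Submodule.span (ZMod 2)
      {((0, ξ', o.1.1, ε' + ξ' + η') : AdaptedSpace U B), (0, η', o.1.2, δ' + ξ')} :=
        he ▸ Submodule.subset_span (by simp)
    have h2 : (0, η, o.1.2, δ + ξ) ∈ Submodule.span (ZMod 2)
      {((0, ξ', o.1.1, ε' + ξ' + η') : AdaptedSpace U B), (0, η', o.1.2, δ' + ξ')} :=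
        he ▸ Submodule.subset_span (by simp)
    rw [mem_span_pair_iff] at h1 h2
    simp [hp, hpq, hq] at h1
    simp [hp, hpq.symm, hq] at h2
    obtain ⟨rfl, h1⟩ := h1
    obtain ⟨rfl, h2⟩ := h2
    rw [add_right_cancel (add_right_cancel h1), add_right_cancel h2]

end TransversalFamily

/-! ### Checks on a plane `⟨p, q⟩` contained in the base -/

section ContainedFamily

variable (W C : Type*) [AddCommGroup W] [Module (ZMod 2) W] [AddCommGroup C] [Module (ZMod 2) C]

/-- Coordinates adapted to a plane contained in a given subspace, here the set of the vectors
whose first component vanishes; the plane is given by the last two components. -/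
abbrev ContainedSpace : Type _ := W × C × ZMod 2 × ZMod 2

/-- The vectors whose first component vanishes. -/
def ContainedSpace.base : Submodule (ZMod 2) (ContainedSpace W C) where
  carrier := {v | v.1 = 0}
  add_mem' := by rintro v w (h1 : _ = _) (h2 : _ = _); simp [h1, h2]
  zero_mem' := by simp
  smul_mem' := by rintro c v (h : _ = _); simp [h]

variable {W C}

open ContainedSpace

theorem ContainedSpace.mem_base {v : ContainedSpace W C} : v ∈ base W C ↔ v.1 = 0 :=
  Iff.rfl

/-- A vector of `𝔽₂²` that is linearly independent of a given nonzero one. -/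
def otherVector (v : ZMod 2 × ZMod 2) : ZMod 2 × ZMod 2 :=
  if v.1 = 0 then (1, 0) else (0, 1)

/-- Pairs of planes meeting the fixed plane in a line. -/
def incidentChecks (j : {v : ZMod 2 × ZMod 2 // v ≠ 0} × {z : W × C // z ≠ 0}) :
    List (ContainedSpace W C × ContainedSpace W C) :=
  [((0, 0, j.1.1), (j.2.1.1, j.2.1.2, 0)), ((0, 0, j.1.1), (j.2.1.1, j.2.1.2, otherVector j.1.1))]

theorem mem_incidentChecks {j : {v : ZMod 2 × ZMod 2 // v ≠ 0} × {z : W × C // z ≠ 0}}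
    {z : ContainedSpace W C × ContainedSpace W C} (hz : z ∈ incidentChecks j) :
    ∃ v, z = ((0, 0, j.1.1), (j.2.1.1, j.2.1.2, v)) := by
  simp only [incidentChecks, List.mem_cons, List.not_mem_nil, or_false] at hz
  rcases hz with rfl | rfl
  exacts [⟨_, rfl⟩, ⟨_, rfl⟩]

/-- The identity is `v ∧ z + v ∧ (z + v') = v ∧ v' = p ∧ q`, for `v, v'` any two distinct nonzero
vectors of the fixed plane. -/
theorem isCheckFamily_incidentChecks :
    IsCheckFamily (base W C) (0, 0, 1, 0) (0, 0, 0, 1) (incidentChecks (W := W) (C := C)) := by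
  constructor
  · intro j z hz
    obtain ⟨v, rfl⟩ := mem_incidentChecks hz
    simp [mem_base]
  · rintro ⟨⟨π, hπ⟩, ⟨w, γ⟩, hwγ⟩ z hz
    obtain ⟨v, rfl⟩ := mem_incidentChecks hz
    rw [Ne, Prod.mk_eq_zero] at hwγ
    simp only [Ne, Prod.mk_eq_zero, Prod.mk.injEq, @eq_comm _ (0 : W), @eq_comm _ (0 : C)]
    tauto
  · rintro ⟨⟨π, hπ⟩, ⟨w, γ⟩, hwγ⟩ φ hφ
    have he : ((w, γ, otherVector π) : ContainedSpace W C) =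
      (w, γ, 0) + (0, 0, otherVector π) := by simp
    simp only [incidentChecks, List.map_cons, List.map_nil, List.sum_cons, List.sum_nil, he,
      map_add, add_zero]
    rw [← add_assoc, add_self_zmod_two, zero_add]
    have hall : ∀ σ τ : ZMod 2, ((0, 0, σ, τ) : ContainedSpace W C) ∈ Submodule.span (ZMod 2)
        {((0, 0, 1, 0) : ContainedSpace W C), (0, 0, 0, 1)} := by
      intro σ τ
      rw [Submodule.mem_span_pair]
      exact ⟨σ, τ, by simp⟩
    have hπ' : otherVector π ≠ 0 ∧ π ≠ otherVector π := by
      clear he; revert π; decide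
    refine alternating_eq_of_mem_span hφ (hall _ _) (hall _ _) ?_ ?_ ?_
    · simpa using hπ
    · simpa using hπ'.1
    · simpa using hπ'.2
  · rintro ⟨⟨π, hπ⟩, ⟨w, γ⟩, hwγ⟩ z hz he
    obtain ⟨v, rfl⟩ := mem_incidentChecks hz
    have h : (w, γ, v) ∈ Submodule.span (ZMod 2)
      {((0, 0, 1, 0) : ContainedSpace W C), (0, 0, 0, 1)} := he ▸ Submodule.subset_span (by simp)
    rw [Ne, Prod.mk_eq_zero] at hwγ
    rw [mem_span_pair_iff] at h
    simp at h
    tauto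
  · rintro ⟨⟨π, hπ⟩, ⟨w, γ⟩, hwγ⟩ ⟨⟨π', hπ'⟩, ⟨w', γ'⟩, hwγ'⟩ z hz z' hz' he
    obtain ⟨v, rfl⟩ := mem_incidentChecks hz
    obtain ⟨v', rfl⟩ := mem_incidentChecks hz'
    have h1 : (0, 0, π) ∈ Submodule.span (ZMod 2)
      {((0, 0, π') : ContainedSpace W C), (w', γ', v')} := he ▸ Submodule.subset_span (by simp)
    have h2 : (w, γ, v) ∈ Submodule.span (ZMod 2)
      {((0, 0, π') : ContainedSpace W C), (w', γ', v')} := he ▸ Submodule.subset_span (by simp)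
    rw [Ne, Prod.mk_eq_zero] at hwγ hwγ'
    rw [mem_span_pair_iff] at h1 h2
    simp only [Prod.mk_eq_zero, Prod.mk.injEq, Prod.mk_add_mk, zero_add, @eq_comm _ (0 : W),
      @eq_comm _ (0 : C), true_and] at h1 h2
    simp only [Prod.mk.injEq, Subtype.mk.injEq]
    tauto

/-- Quadruples of planes through the points of a coset of the fixed plane in the base. -/
def cosetChecks (h : {c : C // c ≠ 0} → C →ₗ[ZMod 2] ZMod 2)
    (j : (c : {c : C // c ≠ 0}) × {w : W // w ≠ 0} × LinearMap.ker (h c) × ZMod 2 × ZMod 2) :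
    List (ContainedSpace W C × ContainedSpace W C) :=
  [((0, j.1.1, 0, 0), (j.2.1.1, j.2.2.1.1, j.2.2.2.1, j.2.2.2.2)),
    ((0, j.1.1, 1, 0), (j.2.1.1, j.2.2.1.1, j.2.2.2.1, j.2.2.2.2)),
    ((0, j.1.1, 0, 1), (j.2.1.1, j.2.2.1.1, j.2.2.2.1, j.2.2.2.2 + 1)),
    ((0, j.1.1, 1, 1), (j.2.1.1, j.2.2.1.1, j.2.2.2.1, j.2.2.2.2 + 1))]

theorem mem_cosetChecks {h : {c : C // c ≠ 0} → C →ₗ[ZMod 2] ZMod 2}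
    {j : (c : {c : C // c ≠ 0}) × {w : W // w ≠ 0} × LinearMap.ker (h c) × ZMod 2 × ZMod 2}
    {z : ContainedSpace W C × ContainedSpace W C} (hz : z ∈ cosetChecks h j) :
    ∃ σ τ, z = ((0, j.1.1, σ, τ), (j.2.1.1, j.2.2.1.1, j.2.2.2.1, j.2.2.2.2 + τ)) := by
  simp only [cosetChecks, List.mem_cons, List.not_mem_nil, or_false] at hz
  rcases hz with rfl | rfl | rfl | rfl
  exacts [⟨0, 0, by simp⟩, ⟨1, 0, by simp⟩, ⟨0, 1, rfl⟩, ⟨1, 1, rfl⟩]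

/-- The first two planes add up to `p ∧ y`, the last two to `p ∧ (y + q)`, where `y = (w, γ, α, β)`.
As for the quadruples above, `γ ∈ ker (h c)` excludes the representative shifted by `c`. -/
theorem isCheckFamily_cosetChecks {h : {c : C // c ≠ 0} → C →ₗ[ZMod 2] ZMod 2}
    (hh : ∀ c, h c c = 1) :
    IsCheckFamily (base W C) (0, 0, 1, 0) (0, 0, 0, 1) (cosetChecks (W := W) h) := by
  constructor
  · intro j z hz
    obtain ⟨σ, τ, rfl⟩ := mem_cosetChecks hz
    simp [mem_base]
  · rintro ⟨⟨c, hc⟩, ⟨w, hw⟩, ⟨γ, hγ⟩, α, β⟩ z hz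
    obtain ⟨σ, τ, rfl⟩ := mem_cosetChecks hz
    simp [hc, hw, hw.symm]
  · rintro ⟨⟨c, hc⟩, ⟨w, hw⟩, ⟨γ, hγ⟩, α, β⟩ φ hφ
    have h1 : ((w, γ, α, β + 1) : ContainedSpace W C) = (w, γ, α, β) + (0, 0, 0, 1) := by simp
    have h2 : ((0, c, 1, 0) : ContainedSpace W C) = (0, c, 0, 0) + (0, 0, 1, 0) := by simp
    have h3 : ((0, c, 0, 1) : ContainedSpace W C) = (0, c, 0, 0) + (0, 0, 0, 1) := by simp
    have h4 : ((0, c, 1, 1) : ContainedSpace W C) =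
      (0, c, 0, 0) + (0, 0, 1, 0) + (0, 0, 0, 1) := by simp
    simp only [cosetChecks, List.map_cons, List.map_nil, List.sum_cons, List.sum_nil, h1, h2, h3,
      h4]
    generalize ((w, γ, α, β) : ContainedSpace W C) = y
    generalize ((0, c, 0, 0) : ContainedSpace W C) = p
    generalize ((0, 0, 1, 0) : ContainedSpace W C) = a
    generalize ((0, 0, 0, 1) : ContainedSpace W C) = b
    simp only [map_add, LinearMap.add_apply, hφ]
    have h2 : (2 : ZMod 2) = 0 := rfl
    linear_combination (2 * φ p y + φ p b + φ a y + φ b y) * h2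
  · rintro ⟨⟨c, hc⟩, ⟨w, hw⟩, ⟨γ, hγ⟩, α, β⟩ z hz he
    obtain ⟨σ, τ, rfl⟩ := mem_cosetChecks hz
    have h : (0, c, σ, τ) ∈ Submodule.span (ZMod 2)
      {((0, 0, 1, 0) : ContainedSpace W C), (0, 0, 0, 1)} := he ▸ Submodule.subset_span (by simp)
    rw [mem_span_pair_iff] at h
    simp [hc] at h
  · rintro ⟨⟨c, hc⟩, ⟨w, hw⟩, ⟨γ, hγ⟩, α, β⟩ ⟨⟨c', hc'⟩, ⟨w', hw'⟩, ⟨γ', hγ'⟩, α', β'⟩ z hz z' hz' he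
    obtain ⟨σ, τ, rfl⟩ := mem_cosetChecks hz
    obtain ⟨σ', τ', rfl⟩ := mem_cosetChecks hz'
    have h1 : (0, c, σ, τ) ∈ Submodule.span (ZMod 2)
      {((0, c', σ', τ') : ContainedSpace W C), (w', γ', α', β' + τ')} :=
        he ▸ Submodule.subset_span (by simp)
    have h2 : (w, γ, α, β + τ) ∈ Submodule.span (ZMod 2)
      {((0, c', σ', τ') : ContainedSpace W C), (w', γ', α', β' + τ')} :=
        he ▸ Submodule.subset_span (by simp)
    rw [mem_span_pair_iff] at h1 h2
    simp [hc, hw'.symm] at h1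
    obtain ⟨rfl, rfl, rfl⟩ := h1
    have hc1 := hh ⟨c, hc⟩
    simp only [LinearMap.mem_ker] at hγ hγ'
    simp [hw] at h2
    rcases h2 with h2 | h2
    · obtain ⟨rfl, rfl, rfl, h2⟩ := h2
      rw [h2]
    · exfalso
      rw [h2.2.1, map_add, hγ', add_zero, hc1] at hγ
      exact one_ne_zero hγ

end ContainedFamily

/-! ### Different kinds of checks share no plane -/

section CrossDisjointness

variable {U B : Type*} [AddCommGroup U] [Module (ZMod 2) U] [AddCommGroup B] [Module (ZMod 2) B]

theorem notMem_span_of_mem_quadrupleChecks {h : {b : B // b ≠ 0} → B →ₗ[ZMod 2] ZMod 2}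
    {j : (b : {b : B // b ≠ 0}) × {u : U // u ≠ 0} × LinearMap.ker (h b) × ZMod 2}
    {w : AdaptedSpace U B × AdaptedSpace U B} (hw : w ∈ quadrupleChecks h j) :
    (0, 0, 0, 1) ∉ Submodule.span (ZMod 2) {w.1, w.2} := by
  obtain ⟨τ, η, rfl⟩ := mem_quadrupleChecks hw
  have hb := j.1.2
  have hu := j.2.1.2
  rw [mem_span_pair_iff]
  simp [hb.symm, hu.symm]

theorem notMem_span_of_mem_pairChecks {j : {b : B // b ≠ 0} × ZMod 2}
    {w : AdaptedSpace U B × AdaptedSpace U B} (hw : w ∈ pairChecks j) :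
    (0, 0, 0, 1) ∉ Submodule.span (ZMod 2) {w.1, w.2} := by
  obtain ⟨τ, rfl⟩ := mem_pairChecks hw
  have hb := j.1.2
  rw [mem_span_pair_iff]
  simp [hb.symm]

theorem notMem_span_of_mem_cyclicChecks {O : Finset (B × B)} (hO : IsPlaneBases O)
    {j : O × ZMod 2 × ZMod 2} {w : AdaptedSpace U B × AdaptedSpace U B} (hw : w ∈ cyclicChecks j)
    (x y : ZMod 2) (hxy : x ≠ 0 ∨ y ≠ 0) :
    (0, x, 0, y) ∉ Submodule.span (ZMod 2) {w.1, w.2} := by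
  obtain ⟨ξ, η, hs⟩ := span_of_mem_cyclicChecks hw
  obtain ⟨hp, hq, hpq⟩ := hO.indep _ j.1.2
  have hpq' : j.1.1.1 + j.1.1.2 ≠ 0 := fun h => hpq (by
    rw [eq_neg_of_add_eq_zero_left h, ← eq_neg_of_add_eq_zero_left (add_self_zmod_two j.1.1.2)])
  rw [hs, mem_span_pair_iff]
  simp [hp.symm, hq.symm, hpq'.symm]
  tauto

theorem fst_eq_zero_of_mem_span {p q v : AdaptedSpace U B} (hp : p.1 = 0) (hq : q.1 = 0)
    (hv : v ∈ Submodule.span (ZMod 2) {p, q}) : v.1 = 0 := by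
  rw [mem_span_pair_iff] at hv
  rcases hv with rfl | rfl | rfl | rfl <;> simp [hp, hq]

theorem fst_eq_zero_of_mem_pairChecks {j : {b : B // b ≠ 0} × ZMod 2}
    {w : AdaptedSpace U B × AdaptedSpace U B} (hw : w ∈ pairChecks j) :
    w.1.1 = 0 ∧ w.2.1 = 0 := by
  obtain ⟨τ, rfl⟩ := mem_pairChecks hw
  exact ⟨rfl, rfl⟩

theorem fst_eq_zero_of_mem_cyclicChecks {O : Finset (B × B)} {j : O × ZMod 2 × ZMod 2}
    {w : AdaptedSpace U B × AdaptedSpace U B} (hw : w ∈ cyclicChecks j) :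
    w.1.1 = 0 ∧ w.2.1 = 0 := by
  simp only [cyclicChecks, List.mem_cons, List.not_mem_nil, or_false] at hw
  rcases hw with rfl | rfl | rfl | rfl <;> exact ⟨rfl, rfl⟩

theorem span_ne_of_mem_quadrupleChecks {h : {b : B // b ≠ 0} → B →ₗ[ZMod 2] ZMod 2}
    {j : (b : {b : B // b ≠ 0}) × {u : U // u ≠ 0} × LinearMap.ker (h b) × ZMod 2}
    {w w' : AdaptedSpace U B × AdaptedSpace U B} (hw : w ∈ quadrupleChecks h j)
    (hw' : w'.1.1 = 0 ∧ w'.2.1 = 0) :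
    Submodule.span (ZMod 2) {w.1, w.2} ≠ Submodule.span (ZMod 2) {w'.1, w'.2} := by
  intro he
  have h2 : w.2 ∈ Submodule.span (ZMod 2) {w'.1, w'.2} := he ▸ Submodule.subset_span (by simp)
  have := fst_eq_zero_of_mem_span hw'.1 hw'.2 h2
  obtain ⟨τ, η, rfl⟩ := mem_quadrupleChecks hw
  exact j.2.1.2 this

theorem mem_span_of_mem_pencilChecks {z : {z : U × B // z ≠ 0}}
    {w : AdaptedSpace U B × AdaptedSpace U B} (hw : w ∈ pencilChecks z) :
    (0, 0, 0, 1) ∈ Submodule.span (ZMod 2) {w.1, w.2} := by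
  obtain ⟨η, rfl⟩ := mem_pencilChecks hw
  exact Submodule.subset_span (by simp)

theorem span_ne_of_mem_incidentChecks {W C : Type*} [AddCommGroup W] [Module (ZMod 2) W]
    [AddCommGroup C] [Module (ZMod 2) C] {h : {c : C // c ≠ 0} → C →ₗ[ZMod 2] ZMod 2}
    {i : {v : ZMod 2 × ZMod 2 // v ≠ 0} × {z : W × C // z ≠ 0}}
    {j : (c : {c : C // c ≠ 0}) × {w : W // w ≠ 0} × LinearMap.ker (h c) × ZMod 2 × ZMod 2}
    {z z' : ContainedSpace W C × ContainedSpace W C} (hz : z ∈ incidentChecks i)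
    (hz' : z' ∈ cosetChecks h j) :
    Submodule.span (ZMod 2) {z.1, z.2} ≠ Submodule.span (ZMod 2) {z'.1, z'.2} := by
  intro he
  have h1 : z.1 ∈ Submodule.span (ZMod 2) {z'.1, z'.2} := he ▸ Submodule.subset_span (by simp)
  obtain ⟨v, rfl⟩ := mem_incidentChecks hz
  obtain ⟨σ, τ, rfl⟩ := mem_cosetChecks hz'
  have hi := i.1.2
  have hc := j.1.2
  have hw := j.2.1.2
  rw [mem_span_pair_iff] at h1
  simp [hi, hc.symm, hw.symm] at h1

end CrossDisjointness

/-! ### Sizes of the combined families -/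

section Counting

theorem card_ne_zero_eq {V : Type*} [AddCommGroup V] [Module (ZMod 2) V] [Finite V] {n : ℕ}
    (hn : finrank (ZMod 2) V = n) : Nat.card {v : V // v ≠ 0} = 2 ^ n - 1 := by
  classical
  have := Fintype.ofFinite V
  rw [Nat.card_eq_fintype_card, Fintype.card_subtype_compl, Fintype.card_subtype_eq,
    ← Nat.card_eq_fintype_card, card_eq_two_pow_finrank, hn]

/-- The kernels serve as complements of the lines `⟨v⟩`. For `n = 0` the truncated exponent is
harmless, as there is no nonzero `v`. -/
theorem exists_ker_card {V : Type*} [AddCommGroup V] [Module (ZMod 2) V] [Finite V] {n : ℕ}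
    (hn : finrank (ZMod 2) V = n) :
    ∃ h : {v : V // v ≠ 0} → V →ₗ[ZMod 2] ZMod 2, (∀ v, h v v = 1) ∧
      ∀ v, Nat.card (LinearMap.ker (h v)) = 2 ^ (n - 1) := by
  choose h hh using fun v : {v : V // v ≠ 0} => exists_dual_eq_one v.2
  refine ⟨h, hh, fun v => ?_⟩
  rw [card_eq_two_pow_finrank, ← hn, ← finrank_ker_add_one (hh v), Nat.add_sub_cancel]

/-- The four kinds are told apart by their planes: only pencil planes contain `a`, only quadruple
planes among the others leave `U = 0`, and pair planes contain some `x + εa` whereas cyclic ones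
meet `⟨a, x⟩` trivially. -/
theorem exists_checkFamily_adaptedSpace {n r : ℕ} {O : Finset ((Fin r → ZMod 2) × (Fin r → ZMod 2))}
    (hO : IsPlaneBases O) :
    ∃ (κ : Type) (_ : Finite κ) (L : κ → List (AdaptedSpace (Fin n → ZMod 2) (Fin r → ZMod 2) ×
        AdaptedSpace (Fin n → ZMod 2) (Fin r → ZMod 2))),
      IsCheckFamily (AdaptedSpace.base _ _) (0, 0, 0, 1) (0, 1, 0, 0) L ∧
      Nat.card κ = (2 ^ (n + r) - 1) + ((2 ^ r - 1) * ((2 ^ n - 1) * (2 ^ (r - 1) * 2)) +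
        ((2 ^ r - 1) * 2 + O.card * 4)) := by
  have hr : finrank (ZMod 2) (Fin r → ZMod 2) = r := finrank_fin_fun _
  have hn : finrank (ZMod 2) (Fin n → ZMod 2) = n := finrank_fin_fun _
  obtain ⟨h, hh, hker⟩ := exists_ker_card hr
  have hfin : ∀ b, Finite (LinearMap.ker (h b)) := fun b => inferInstance
  refine ⟨_, ?_, _, (isCheckFamily_pencilChecks.sumElim ((isCheckFamily_quadrupleChecks hh).sumElim
    (isCheckFamily_pairChecks.sumElim (isCheckFamily_cyclicChecks hO) ?_) ?_) ?_), ?_⟩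
  · infer_instance
  · intro j w hw j' w' hw' he
    refine notMem_span_of_mem_cyclicChecks hO hw' 1 j.2 (Or.inl one_ne_zero) (he ▸ ?_)
    obtain ⟨τ, rfl⟩ := mem_pairChecks hw
    exact Submodule.subset_span (by simp)
  · rintro j w hw (j' | j') w' hw'
    · exact span_ne_of_mem_quadrupleChecks hw (fst_eq_zero_of_mem_pairChecks hw')
    · exact span_ne_of_mem_quadrupleChecks hw (fst_eq_zero_of_mem_cyclicChecks hw')
  · rintro j w hw (j' | j' | j') w' hw' he
    · exact notMem_span_of_mem_quadrupleChecks hw' (he ▸ mem_span_of_mem_pencilChecks hw)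
    · exact notMem_span_of_mem_pairChecks hw' (he ▸ mem_span_of_mem_pencilChecks hw)
    · exact notMem_span_of_mem_cyclicChecks hO hw' 0 1 (Or.inr one_ne_zero)
        (he ▸ mem_span_of_mem_pencilChecks hw)
  · have hnr : finrank (ZMod 2) ((Fin n → ZMod 2) × (Fin r → ZMod 2)) = n + r := by
      rw [finrank_prod, hn, hr]
    have hOc : Nat.card O = O.card := by simp
    simp only [Nat.card_sum, Nat.card_prod, Nat.card_sigma, hker, card_ne_zero_eq hr,
      card_ne_zero_eq hn, card_ne_zero_eq hnr, Nat.card_zmod, hOc, Finset.sum_const,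
      Finset.card_univ, smul_eq_mul, ← Nat.card_eq_fintype_card, Nat.reduceMul]

theorem exists_checkFamily_containedSpace (n r : ℕ) :
    ∃ (κ : Type) (_ : Finite κ) (L : κ → List (ContainedSpace (Fin n → ZMod 2) (Fin r → ZMod 2) ×
        ContainedSpace (Fin n → ZMod 2) (Fin r → ZMod 2))),
      IsCheckFamily (ContainedSpace.base _ _) (0, 0, 1, 0) (0, 0, 0, 1) L ∧
      Nat.card κ = 3 * (2 ^ (n + r) - 1) +
        (2 ^ r - 1) * ((2 ^ n - 1) * (2 ^ (r - 1) * 4)) := by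
  have hr : finrank (ZMod 2) (Fin r → ZMod 2) = r := finrank_fin_fun _
  have hn : finrank (ZMod 2) (Fin n → ZMod 2) = n := finrank_fin_fun _
  obtain ⟨h, hh, hker⟩ := exists_ker_card hr
  refine ⟨_, ?_, _, (isCheckFamily_incidentChecks.sumElim (isCheckFamily_cosetChecks hh) ?_), ?_⟩
  · infer_instance
  · exact fun j z hz j' z' hz' => span_ne_of_mem_incidentChecks hz hz'
  · have hnr : finrank (ZMod 2) ((Fin n → ZMod 2) × (Fin r → ZMod 2)) = n + r := by
      rw [finrank_prod, hn, hr]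
    have h2 : finrank (ZMod 2) (ZMod 2 × ZMod 2) = 2 := by simp
    simp only [Nat.card_sum, Nat.card_prod, Nat.card_sigma, hker, card_ne_zero_eq h2,
      card_ne_zero_eq hn, card_ne_zero_eq hnr, card_ne_zero_eq hr, Nat.card_zmod, Finset.sum_const,
      Finset.card_univ, smul_eq_mul, ← Nat.card_eq_fintype_card, Nat.reduceMul]
    rfl

end Counting

/-! ### Coordinates of `V` adapted to a plane and a subspace -/

section Coordinates

variable {V : Type*} [AddCommGroup V] [Module (ZMod 2) V] [Finite V]

theorem exists_injective_disjoint {S T : Submodule (ZMod 2) V} (hST : S ≤ T) {r : ℕ}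
    (hr : finrank (ZMod 2) T = r + finrank (ZMod 2) S) :
    ∃ g : (Fin r → ZMod 2) →ₗ[ZMod 2] V, Function.Injective g ∧ LinearMap.range g ≤ T ∧
      Disjoint (LinearMap.range g) S := by
  obtain ⟨C, hC⟩ := exists_isCompl S
  have hsup : S ⊔ C ⊓ T = T := by
    rw [← sup_inf_assoc_of_le C hST, hC.sup_eq_top, top_inf_eq]
  have hdisj : Disjoint S (C ⊓ T) := hC.disjoint.mono_right inf_le_left
  have hfr := Submodule.finrank_sup_add_finrank_inf_eq S (C ⊓ T)
  rw [hsup, hdisj.eq_bot, finrank_bot] at hfr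
  have he : finrank (ZMod 2) (Fin r → ZMod 2) = finrank (ZMod 2) (C ⊓ T : Submodule (ZMod 2) V) := by
    rw [finrank_fin_fun]; omega
  let e := LinearEquiv.ofFinrankEq _ _ he
  have hrange : LinearMap.range ((C ⊓ T).subtype ∘ₗ e.toLinearMap) = C ⊓ T := by
    rw [LinearMap.range_comp, LinearEquiv.range, Submodule.map_top, Submodule.range_subtype]
  refine ⟨(C ⊓ T).subtype ∘ₗ e.toLinearMap, ?_, ?_, ?_⟩
  · exact (Submodule.subtype_injective _).comp e.injective
  · rw [hrange]; exact inf_le_right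
  · rw [hrange]; exact hdisj.symm

theorem coprod_injective {X Y : Type*} [AddCommGroup X] [Module (ZMod 2) X] [AddCommGroup Y]
    [Module (ZMod 2) Y] {f : X →ₗ[ZMod 2] V} {g : Y →ₗ[ZMod 2] V} (hf : Function.Injective f)
    (hg : Function.Injective g) (hd : Disjoint (LinearMap.range f) (LinearMap.range g)) :
    Function.Injective (f.coprod g) := by
  rw [← LinearMap.ker_eq_bot, LinearMap.ker_coprod_of_disjoint_range f g hd,
    LinearMap.ker_eq_bot.mpr hf, LinearMap.ker_eq_bot.mpr hg, Submodule.prod_bot]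

theorem toSpanSingleton_injective {v : V} (hv : v ≠ 0) :
    Function.Injective (LinearMap.toSpanSingleton (ZMod 2) V v) :=
  LinearMap.ker_eq_bot.mp (LinearMap.ker_toSpanSingleton (ZMod 2) hv)

theorem exists_adaptedSpace_embedding {A : Submodule (ZMod 2) V} {n r : ℕ}
    (hA : finrank (ZMod 2) A = r + 1) (hV : finrank (ZMod 2) V = n + (r + 2)) {a x : V}
    (ha : a ∈ A) (ha0 : a ≠ 0) (hx : x ∉ A) :
    ∃ f : AdaptedSpace (Fin n → ZMod 2) (Fin r → ZMod 2) →ₗ[ZMod 2] V, Function.Injective f ∧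
      f (0, 0, 0, 1) = a ∧ f (0, 1, 0, 0) = x ∧ ∀ v ∈ AdaptedSpace.base _ _, f v ∈ A := by
  have hx0 : x ≠ 0 := fun h => hx (h ▸ zero_mem _)
  obtain ⟨g, hg, hgA, hgd⟩ := exists_injective_disjoint (r := r)
    ((Submodule.span_singleton_le_iff_mem a A).mpr ha) (by rw [finrank_span_singleton ha0, hA])
  have hxA : Disjoint A (Submodule.span (ZMod 2) {x}) :=
    (Submodule.disjoint_span_singleton' hx0).mpr hx
  have hsup := Submodule.finrank_sup_add_finrank_inf_eq A (Submodule.span (ZMod 2) {x})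
  rw [hxA.eq_bot, finrank_bot, finrank_span_singleton hx0] at hsup
  obtain ⟨k, hk, -, hkd⟩ := exists_injective_disjoint (r := n)
    (le_top : A ⊔ Submodule.span (ZMod 2) {x} ≤ ⊤) (by rw [finrank_top, hV]; omega)
  have h1 : LinearMap.range (g.coprod (LinearMap.toSpanSingleton (ZMod 2) V a)) ≤ A := by
    rw [LinearMap.range_coprod, LinearMap.range_toSpanSingleton]
    exact sup_le hgA ((Submodule.span_singleton_le_iff_mem a A).mpr ha)
  refine ⟨k.coprod ((LinearMap.toSpanSingleton (ZMod 2) V x).coprod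
    (g.coprod (LinearMap.toSpanSingleton (ZMod 2) V a))), ?_, ?_, ?_, ?_⟩
  · refine coprod_injective hk (coprod_injective (toSpanSingleton_injective hx0)
      (coprod_injective hg (toSpanSingleton_injective ha0) ?_) ?_) ?_
    · rwa [LinearMap.range_toSpanSingleton]
    · rw [LinearMap.range_toSpanSingleton]
      exact hxA.symm.mono_right h1
    · refine hkd.mono_right ?_
      rw [LinearMap.range_coprod, LinearMap.range_toSpanSingleton, sup_comm]
      exact sup_le_sup_right h1 _
  · simp
  · simp
  · rintro ⟨u, ξ, β, α⟩ ⟨hu, hξ⟩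
    obtain rfl : u = 0 := hu
    obtain rfl : ξ = 0 := hξ
    simpa using add_mem (hgA (LinearMap.mem_range_self g β)) (A.smul_mem α ha)

theorem exists_containedSpace_embedding {A : Submodule (ZMod 2) V} {n r : ℕ}
    (hA : finrank (ZMod 2) A = r + 2) (hV : finrank (ZMod 2) V = n + (r + 2)) {p q : V}
    (hp : p ∈ A) (hq : q ∈ A) (hp0 : p ≠ 0) (hq0 : q ≠ 0) (hpq : q ∉ Submodule.span (ZMod 2) {p}) :
    ∃ f : ContainedSpace (Fin n → ZMod 2) (Fin r → ZMod 2) →ₗ[ZMod 2] V, Function.Injective f ∧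
      f (0, 0, 1, 0) = p ∧ f (0, 0, 0, 1) = q ∧ ∀ v ∈ ContainedSpace.base _ _, f v ∈ A := by
  have hne : p ≠ q := fun h => hpq (h ▸ Submodule.mem_span_singleton_self p)
  have hle : Submodule.span (ZMod 2) {p, q} ≤ A :=
    Submodule.span_le.mpr (Set.insert_subset hp (Set.singleton_subset_iff.mpr hq))
  have hrange : LinearMap.range ((LinearMap.toSpanSingleton (ZMod 2) V p).coprod
      (LinearMap.toSpanSingleton (ZMod 2) V q)) = Submodule.span (ZMod 2) {p, q} := by
    rw [LinearMap.range_coprod, LinearMap.range_toSpanSingleton, LinearMap.range_toSpanSingleton,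
      Submodule.span_insert]
  obtain ⟨g, hg, hgA, hgd⟩ := exists_injective_disjoint (r := r) hle
    (by rw [finrank_span_pair hp0 hq0 hne, hA])
  obtain ⟨k, hk, -, hkd⟩ := exists_injective_disjoint (r := n) (le_top : A ≤ ⊤)
    (by rw [finrank_top, hV, hA])
  refine ⟨k.coprod (g.coprod ((LinearMap.toSpanSingleton (ZMod 2) V p).coprod
    (LinearMap.toSpanSingleton (ZMod 2) V q))), ?_, ?_, ?_, ?_⟩
  · refine coprod_injective hk (coprod_injective hg (coprod_injective
      (toSpanSingleton_injective hp0) (toSpanSingleton_injective hq0) ?_) ?_) ?_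
    · rw [LinearMap.range_toSpanSingleton, LinearMap.range_toSpanSingleton]
      exact (Submodule.disjoint_span_singleton' hq0).mpr hpq
    · rwa [hrange]
    · refine hkd.mono_right ?_
      rw [LinearMap.range_coprod, hrange]
      exact sup_le hgA hle
  · simp
  · simp
  · rintro ⟨w, γ, α, β⟩ (hw : w = 0)
    subst hw
    simpa using add_mem (hgA (LinearMap.mem_range_self g γ))
      (add_mem (A.smul_mem α hp) (A.smul_mem β hq))

end Coordinates

/-! ### Enough orthogonal checks at every point -/

section Decoder

variable {V : Type*} [AddCommGroup V] [Module (ZMod 2) V] [Finite V]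

theorem notMem_span_singleton {p q : V} (hq : q ≠ 0) (hpq : p ≠ q) :
    q ∉ Submodule.span (ZMod 2) {p} := by
  rw [Submodule.mem_span_singleton]
  rintro ⟨c, rfl⟩
  rcases zmod_two_eq c with rfl | rfl <;> simp at hq hpq

variable {m : ℕ} (b : Basis (Fin m) (ZMod 2) V)
  (B : ∀ P : Grassmannian (ZMod 2) V 2, Basis (Fin 2) (ZMod 2) P.1)
  {A : Fin 2 → Submodule (ZMod 2) V} {A' : Submodule (ZMod 2) V}

/-- Discarding checks preserves orthogonality, so all points can be given the same number `N`. -/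
theorem exists_orthogonal_of_le_card
    (hA : ∀ u v, u ∈ A' → u ≠ 0 → ∀ h : finrank (ZMod 2) (Submodule.span (ZMod 2) {u, v}) = 2,
      (⟨Submodule.span (ZMod 2) {u, v}, h⟩ : Grassmannian (ZMod 2) V 2) ∈ schubertVariety A)
    (Q : schubertVariety A) {p q : V} (hp : p ≠ 0) (hpq : q ∉ Submodule.span (ZMod 2) {p})
    (hQ : Q.1.1 = Submodule.span (ZMod 2) {p, q}) {κ : Type} [Finite κ]
    {L : κ → List (V × V)} (hL : IsCheckFamily A' p q L) {N : ℕ} (hN : N ≤ Nat.card κ) :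
    ∃ J, IsOrthogonalOn (schubertCode b B A) Q J ∧ J.card = N := by
  have := Fintype.ofFinite κ
  obtain ⟨J, hJ, hcard⟩ := exists_orthogonal_of_isCheckFamily b B hA Q hp hpq hQ hL
  rw [Nat.card_eq_fintype_card, ← hcard] at hN
  obtain ⟨J', hJ', hcard'⟩ := Finset.exists_subset_card_eq hN
  exact ⟨J', ⟨fun w hw => hJ.1 w (hJ' hw), fun w hw => hJ.2.1 w (hJ' hw),
    fun j hj w hw w' hw' => hJ.2.2 j hj w (hJ' hw) w' (hJ' hw')⟩, hcard'⟩

theorem exists_orthogonal_of_transversal {n r : ℕ}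
    (hA : ∀ u v, u ∈ A' → u ≠ 0 → ∀ h : finrank (ZMod 2) (Submodule.span (ZMod 2) {u, v}) = 2,
      (⟨Submodule.span (ZMod 2) {u, v}, h⟩ : Grassmannian (ZMod 2) V 2) ∈ schubertVariety A)
    (hA' : finrank (ZMod 2) A' = r + 1) (hV : finrank (ZMod 2) V = n + (r + 2))
    {O : Finset ((Fin r → ZMod 2) × (Fin r → ZMod 2))} (hO : IsPlaneBases O)
    (Q : schubertVariety A) {a x : V} (ha : a ∈ A') (ha0 : a ≠ 0) (hx : x ∉ A')
    (hQ : Q.1.1 = Submodule.span (ZMod 2) {a, x}) {N : ℕ}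
    (hN : N ≤ (2 ^ (n + r) - 1) + ((2 ^ r - 1) * ((2 ^ n - 1) * (2 ^ (r - 1) * 2)) +
        ((2 ^ r - 1) * 2 + O.card * 4))) :
    ∃ J, IsOrthogonalOn (schubertCode b B A) Q J ∧ J.card = N := by
  obtain ⟨f, hf, hfa, hfx, hfA⟩ := exists_adaptedSpace_embedding hA' hV ha ha0 hx
  obtain ⟨κ, _, L, hL, hcard⟩ := exists_checkFamily_adaptedSpace (n := n) hO
  have h := hL.map hf hfA
  rw [hfa, hfx] at h
  refine exists_orthogonal_of_le_card b B hA Q ha0 ?_ hQ h (hcard ▸ hN)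
  exact fun hxa => hx ((Submodule.span_singleton_le_iff_mem a A').mpr ha hxa)

theorem exists_orthogonal_of_contained {n r : ℕ}
    (hA : ∀ u v, u ∈ A' → u ≠ 0 → ∀ h : finrank (ZMod 2) (Submodule.span (ZMod 2) {u, v}) = 2,
      (⟨Submodule.span (ZMod 2) {u, v}, h⟩ : Grassmannian (ZMod 2) V 2) ∈ schubertVariety A)
    (hA' : finrank (ZMod 2) A' = r + 2) (hV : finrank (ZMod 2) V = n + (r + 2))
    (Q : schubertVariety A) {p q : V} (hp : p ∈ A') (hq : q ∈ A') (hp0 : p ≠ 0) (hq0 : q ≠ 0)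
    (hpq : p ≠ q) (hQ : Q.1.1 = Submodule.span (ZMod 2) {p, q}) {N : ℕ}
    (hN : N ≤ 3 * (2 ^ (n + r) - 1) + (2 ^ r - 1) * ((2 ^ n - 1) * (2 ^ (r - 1) * 4))) :
    ∃ J, IsOrthogonalOn (schubertCode b B A) Q J ∧ J.card = N := by
  have hpq' := notMem_span_singleton hq0 hpq
  obtain ⟨f, hf, hfp, hfq, hfA⟩ := exists_containedSpace_embedding hA' hV hp hq hp0 hq0 hpq'
  obtain ⟨κ, _, L, hL, hcard⟩ := exists_checkFamily_containedSpace n r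
  have h := hL.map hf hfA
  rw [hfp, hfq] at h
  exact exists_orthogonal_of_le_card b B hA Q hp0 hpq' hQ h (hcard ▸ hN)

theorem mem_schubertVariety_of_hyperplane {s : ℕ} (hV : finrank (ZMod 2) V = s + 1)
    (hA0 : finrank (ZMod 2) (A 0) = s) (hA1 : A 1 = ⊤) (P : Grassmannian (ZMod 2) V 2) :
    P ∈ schubertVariety A := by
  refine Fin.forall_fin_two.mpr ⟨?_, ?_⟩
  · change 1 ≤ finrank (ZMod 2) (P.1 ⊓ A 0 : Submodule (ZMod 2) V)
    have h1 := Submodule.finrank_sup_add_finrank_inf_eq P.1 (A 0)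
    have h2 := Submodule.finrank_le (P.1 ⊔ A 0)
    have h3 := P.2
    omega
  · change 2 ≤ finrank (ZMod 2) (P.1 ⊓ A 1 : Submodule (ZMod 2) V)
    rw [hA1, inf_top_eq, P.2]

theorem majorityLogicCorrects_schubertCode {n r : ℕ} (hA0 : finrank (ZMod 2) (A 0) = r + 2)
    (hA1 : A 1 = ⊤) (hV : finrank (ZMod 2) V = n + (r + 3))
    {O : Finset ((Fin (r + 1) → ZMod 2) × (Fin (r + 1) → ZMod 2))} (hO : IsPlaneBases O)
    {t : ℕ} (hN : 2 * t ≤ (2 ^ (n + (r + 1)) - 1) +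
      ((2 ^ (r + 1) - 1) * ((2 ^ n - 1) * (2 ^ r * 2)) + ((2 ^ (r + 1) - 1) * 2 + O.card * 4)))
    (hN' : n = 0 ∨ 2 * t ≤ 3 * (2 ^ (n + 1 + r) - 1) +
      (2 ^ r - 1) * ((2 ^ (n + 1) - 1) * (2 ^ (r - 1) * 4))) :
    MajorityLogicCorrects (schubertCode b B A) t := by
  have hmem : ∀ u v, u ∈ A 0 → u ≠ 0 →
      ∀ h : finrank (ZMod 2) (Submodule.span (ZMod 2) {u, v}) = 2,
      (⟨Submodule.span (ZMod 2) {u, v}, h⟩ : Grassmannian (ZMod 2) V 2) ∈ schubertVariety A :=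
    fun u v hu hu0 h => span_pair_mem_schubertVariety hA1 hu hu0 h
  have key : ∀ Q : schubertVariety A,
      ∃ J, IsOrthogonalOn (schubertCode b B A) Q J ∧ J.card = 2 * t := by
    intro Q
    have h1 : 1 ≤ finrank (ZMod 2) (Q.1.1 ⊓ A 0 : Submodule (ZMod 2) V) := Q.2 0
    obtain ⟨a, ha, ha0⟩ := (Q.1.1 ⊓ A 0).ne_bot_iff.mp fun h => by
      rw [h, finrank_bot] at h1; omega
    obtain ⟨x, hxQ, hx0, hax, hQ⟩ := exists_eq_span_pair Q.1.2 ha.1 ha0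
    by_cases hx : x ∈ A 0
    · rcases hN' with rfl | hN'
      -- Here `A 0` is a hyperplane, so it may be replaced by `ker f`, which does not contain `a`.
      -- The plane meets `ker f` in the line of `x + f x • a`, and the transversal checks apply with
      -- this vector and `a` in the roles of `a` and `x`.
      · obtain ⟨f, hfa⟩ := exists_dual_eq_one ha0
        have hker := finrank_ker_add_one hfa
        have hy : x + f x • a ∈ LinearMap.ker f := by
          simp [hfa, add_self_zmod_two]
        refine exists_orthogonal_of_transversal b B (A' := LinearMap.ker f) (n := 0) (a := x + f x • a)
          (x := a) ?_ (by omega) hV hO Q hy ?_ (by simp [hfa]) ?_ hN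
        · exact fun u v _ _ h => mem_schubertVariety_of_hyperplane (by omega) hA0 hA1 _
        · intro h
          apply notMem_span_singleton hx0 hax
          rw [Submodule.mem_span_singleton]
          refine ⟨f x, ?_⟩
          exact (eq_neg_of_add_eq_zero_left (add_self_zmod_two _)).trans
            (eq_neg_of_add_eq_zero_left h).symm
        · rw [hQ]
          rcases zmod_two_eq (f x) with h | h
          · rw [h, zero_smul, add_zero, Set.pair_comm]
          · rw [h, one_smul, Set.pair_comm, span_pair_add_right, Set.pair_comm]
      · exact exists_orthogonal_of_contained b B hmem hA0 (n := n + 1) (by omega) Q ha.2 hx ha0 hx0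
          hax hQ hN'
    · exact exists_orthogonal_of_transversal b B hmem hA0 hV hO Q ha.2 ha0 hx hQ hN
  choose J hJ using key
  exact majorityLogicCorrects_of_orthogonal le_rfl J hJ

end Decoder

/-! ### The planes of `𝔽₂²` and `𝔽₂³` -/

section PlaneBases

/-- Replacing equality of spans by the list of the four vectors of a plane makes the condition
decidable. -/
theorem IsPlaneBases.of_forall_mem {B : Type*} [AddCommGroup B] [Module (ZMod 2) B]
    {O : Finset (B × B)} (h : ∀ o ∈ O, o.1 ≠ 0 ∧ o.2 ≠ 0 ∧ o.1 ≠ o.2)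
    (h' : ∀ o ∈ O, ∀ o' ∈ O, (o.1 = 0 ∨ o.1 = o'.1 ∨ o.1 = o'.2 ∨ o.1 = o'.1 + o'.2) →
      (o.2 = 0 ∨ o.2 = o'.1 ∨ o.2 = o'.2 ∨ o.2 = o'.1 + o'.2) → o = o') : IsPlaneBases O := by
  refine ⟨h, fun o ho o' ho' he => h' o ho o' ho' ?_ ?_⟩
  · exact mem_span_pair_iff.mp (he ▸ Submodule.subset_span (by simp))
  · exact mem_span_pair_iff.mp (he ▸ Submodule.subset_span (by simp))

/-- The basis of the plane `𝔽₂²`. -/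
def planeBasesTwo : Finset ((Fin 2 → ZMod 2) × (Fin 2 → ZMod 2)) :=
  {(![1, 0], ![0, 1])}

theorem isPlaneBases_planeBasesTwo : IsPlaneBases planeBasesTwo :=
  .of_forall_mem (by decide) (by decide)

/-- Bases of the seven planes of `𝔽₂³`, permuted by a Singer cycle. -/
def planeBasesThree : Finset ((Fin 3 → ZMod 2) × (Fin 3 → ZMod 2)) :=
  {(![1, 0, 0], ![0, 1, 0]), (![0, 1, 0], ![0, 0, 1]), (![0, 0, 1], ![1, 1, 0]),
    (![1, 1, 0], ![0, 1, 1]), (![0, 1, 1], ![1, 1, 1]), (![1, 1, 1], ![1, 0, 1]),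
    (![1, 0, 1], ![1, 0, 0])}

theorem isPlaneBases_planeBasesThree : IsPlaneBases planeBasesThree :=
  .of_forall_mem (by decide) (by decide)

end PlaneBases

end SchubertCode

theorem corollary5p13 {V : Type*} [AddCommGroup V] [Module (ZMod 2) V] [Finite V]
    (m α₁ : ℕ) (hα : α₁ < m)
    (b : Module.Basis (Fin m) (ZMod 2) V)
    (B : ∀ P : SchubertCode.Grassmannian (ZMod 2) V 2, Module.Basis (Fin 2) (ZMod 2) P.1)
    (A : Fin 2 → Submodule (ZMod 2) V) (hA : SchubertCode.IsPartialFlag A ![α₁, m]) :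
    (α₁ = 2 → SchubertCode.MajorityLogicCorrects (SchubertCode.schubertCode b B A)
      ((SchubertCode.minDist (SchubertCode.schubertCode b B A) - 1) / 2)) ∧
    (α₁ = 3 → SchubertCode.MajorityLogicCorrects (SchubertCode.schubertCode b B A)
      ((SchubertCode.minDist (SchubertCode.schubertCode b B A) - 1) / 2 - 1)) ∧
    (α₁ = 4 → SchubertCode.MajorityLogicCorrects (SchubertCode.schubertCode b B A)
      ((SchubertCode.minDist (SchubertCode.schubertCode b B A) - 1) / 2 - 7)) := by
  have hV : finrank (ZMod 2) V = m := by simpa using finrank_eq_card_basis b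
  have hA0 : finrank (ZMod 2) (A 0) = α₁ := hA.2 0
  have hA1 : A 1 = ⊤ := Submodule.eq_top_of_finrank_eq ((hA.2 1).trans hV.symm)
  refine ⟨?_, ?_, ?_⟩ <;> rintro rfl
  · have hd := SchubertCode.minDist_schubertCode_le b B A (by norm_num) hα hA
    obtain ⟨n, rfl⟩ := Nat.exists_eq_add_of_lt hα
    have h2 := Nat.one_le_two_pow (n := n)
    rw [show 2 + n + 1 + 2 - 3 = n + 2 by omega, pow_add] at hd
    -- The line `B` contains no plane, hence `O = ∅`. The counts are `2^(n+2) - 1` and `3 * (2^(n+1)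
    -- - 1)`, against `d ≤ 2^(n+2)`.
    refine SchubertCode.majorityLogicCorrects_schubertCode b B (n := n) (r := 0) (O := ∅) hA0 hA1
      (by omega) ⟨by simp, by simp⟩ ?_ (Or.inr ?_)
    all_goals
      simp only [pow_add, Finset.card_empty]
      omega
  · have hd := SchubertCode.minDist_schubertCode_le b B A (by norm_num) hα hA
    obtain ⟨n, rfl⟩ := Nat.exists_eq_add_of_lt hα
    have h2 := Nat.one_le_two_pow (n := n)
    rw [show 3 + n + 1 + 3 - 3 = n + 4 by omega, pow_add] at hd
    -- The counts are `2^(n+4) - 3` and `20 * 2^n - 7`; at most `2^(n+4) - 4` checks are needed.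
    refine SchubertCode.majorityLogicCorrects_schubertCode b B (n := n) (r := 1) hA0 hA1
      (by omega) SchubertCode.isPlaneBases_planeBasesTwo ?_ (Or.inr ?_)
    · rw [show SchubertCode.planeBasesTwo.card = 1 by decide]
      simp only [pow_add]
      omega
    · simp only [pow_add]
      omega
  · have hd := SchubertCode.minDist_schubertCode_le b B A (by norm_num) hα hA
    obtain ⟨n, rfl⟩ := Nat.exists_eq_add_of_lt hα
    have h2 := Nat.one_le_two_pow (n := n)
    rw [show 4 + n + 1 + 4 - 3 = n + 6 by omega, pow_add] at hd
    -- The counts are `2^(n+6) - 15` and `72 * 2^n - 27`, and up to `2^(n+6) - 16` checks may be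
    -- needed. The second count falls short exactly for `n = 0`.
    refine SchubertCode.majorityLogicCorrects_schubertCode b B (n := n) (r := 2) hA0 hA1
      (by omega) SchubertCode.isPlaneBases_planeBasesThree ?_ ?_
    · rw [show SchubertCode.planeBasesThree.card = 7 by decide]
      simp only [pow_add]
      omega
    · rcases Nat.eq_zero_or_pos n with hn | hn
      · exact Or.inl hn
      · have h3 : 2 ^ 1 ≤ 2 ^ n := Nat.pow_le_pow_right (by norm_num) hn
        simp only [pow_add]
        omega
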